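/- **Definitions.** Let $m$ be Lebesgue measure on $\mathbb R$. For $K\in\mathbb R$ and $N\in(-\infty,\infty]$ let $\delta=\frac{K}{N-1}$ if $N\notin\{1,\infty\}$ and $\delta=0$ otherwise, and put $$\mathfrak s_\delta(x)=\begin{cases}\sin(\sqrt\delta x)/\sqrt\delta&\delta>0\\ x&\delta=0\\ \sinh(\sqrt{-\delta}x)/\sqrt{-\delta}&\delta<0\end{cases}\qquad \mathfrak c_\delta(x)=\begin{cases}\cos(\sqrt\delta x)&\delta>0\\ 1&\delta=0\\ \cosh(\sqrt{-\delta}x)&\delta<0.\end{cases}$$ For a continuous $f:\mathbb R\to\mathbb R$ with $f(0)\ge 0$ let $f_+=f\cdot 1_{[z_-,z_+]}$, where $z_-=\sup\{x\le 0: f(x)=0\}$ and $z_+=\inf\{x>0:f(x)=0\}$ (with $\sup\emptyset=-\infty$, $\inf\emptyset=+\infty$). For $h\in\mathbb R$ define $J_{K,N,h}:\mathbb R\to[0,\infty]$ by $$J_{K,N,h}(x)=\begin{cases}\bigl(\mathfrak c_\delta(x)+\tfrac{h}{N-1}\mathfrak s_\delta(x)\bigr)_+^{N-1}&N\notin\{1,\infty\}\\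 \exp(hx-\tfrac K2x^2)&N=\infty\\ 1&N=1,\end{cases}$$ where $0^{N-1}=+\infty$ if $N<1$. For measurable $f:\mathbb R\to[0,\infty]$ let $\mathfrak{supp}(f)=\operatorname{supp}(f\,dm)\cap\operatorname{supp}(f^{-1}dm)$. For $D\in(0,\infty)$ let $$\mathcal D^{reg}_{(K,N,D)}=\bigl\{(h,d)\in\mathbb R\times(0,D]:\ [-\tfrac d2,\tfrac d2]\subset \operatorname{int}\,\mathfrak{supp}(J_{K,N,h})\bigr\}.$$ For a measure $\xi$ on $\mathbb R$ let $$\Lambda_{Poi}(\xi)=\inf\left\{\frac{\int (f')^2d\xi}{\int f^2d\xi}\ :\ 0\not\equiv f\in C_c^\infty(\mathbb R),\ \int f\,d\xi=0\right\},$$ the quotient being $+\infty$ when $\int f^2d\xi=0$, and let $\lambda(h,d)=\Lambda_{Poi}\bigl(J_{K,N,h}\,1_{[-d/2,d/2]}\,m\bigr)$ for $(h,d)\in\mathcal D^{reg}_{(K,N,D)}$ (the Neumann spectral gap of this measure). **Theorem.** Let $K\in\mathbb R$, $N\in(-\infty,0]\cup(1,\infty]$ and $D\in(0,\infty)$. 1.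 For every fixed $h_0$, the function $d\mapsto\lambda(h_0,d)$ is non-increasing on $\{d:(h_0,d)\in\mathcal D^{reg}_{(K,N,D)}\}$. 2. For every fixed $d_0$ and all $h_1,h_2$ with $(h_1,d_0),(h_2,d_0)\in\mathcal D^{reg}_{(K,N,D)}$: - (a) if $N\in(-\infty,-1)\cup(1,\infty]$ and $|h_1|\le|h_2|$, then $\lambda(h_1,d_0)\le\lambda(h_2,d_0)$; - (b) if $N\in(-1,0]$ and $|h_1|\le|h_2|$, then $\lambda(h_1,d_0)\ge\lambda(h_2,d_0)$; - (c) if $N=-1$, then $\lambda(h_1,d_0)=\lambda(h_2,d_0)$. -/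

import Mathlib

open MeasureTheory Set Filter Topology
open scoped ENNReal ContDiff

noncomputable section

/-- The range `(-∞, ∞]` of the dimension parameter `N` is `WithTop ℝ`;
`δ(K,N) = K / (N - 1)`, understood as `0` when `N ∈ {1, ∞}`. -/
def modelDelta (K : ℝ) : WithTop ℝ → ℝ
  | ⊤ => 0
  | (N : ℝ) => if N = 1 then 0 else K / (N - 1)

/-- The generalised sine `s_δ`. -/
def sinDelta (δ x : ℝ) : ℝ :=
  if 0 < δ then Real.sin (√δ * x) / √δ
  else if δ = 0 then x
  else Real.sinh (√(-δ) * x) / √(-δ)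

/-- The generalised cosine `c_δ`. -/
def cosDelta (δ x : ℝ) : ℝ :=
  if 0 < δ then Real.cos (√δ * x)
  else if δ = 0 then 1
  else Real.cosh (√(-δ) * x)

/-- The last zero of `f` in `(-∞, 0]`, equal to `-∞` if there is none. -/
def leftZero (f : ℝ → ℝ) : EReal := sSup ((fun x : ℝ => (x : EReal)) '' {x | x ≤ 0 ∧ f x = 0})

/-- The first zero of `f` in `(0, ∞)`, equal to `+∞` if there is none. -/
def rightZero (f : ℝ → ℝ) : EReal := sInf ((fun x : ℝ => (x : EReal)) '' {x | 0 < x ∧ f x = 0})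

/-- `f₊ = f · 1_{[leftZero f, rightZero f]}`. -/
def zeroCut (f : ℝ → ℝ) : ℝ → ℝ :=
  Set.indicator {x : ℝ | leftZero f ≤ (x : EReal) ∧ (x : EReal) ≤ rightZero f} f

/-- The model density `J_{K,N,h} : ℝ → [0, ∞]`. The power is taken in `[0, ∞]`, so that
`0 ^ (N - 1) = ∞` when `N < 1`. -/
def modelDensity (K : ℝ) (N : WithTop ℝ) (h x : ℝ) : ℝ≥0∞ :=
  match N with
  | ⊤ => ENNReal.ofReal (Real.exp (h * x - K / 2 * x ^ 2))
  | (N : ℝ) =>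
    if N = 1 then 1
    else
      ENNReal.ofReal
        (zeroCut (fun y => cosDelta (modelDelta K N) y
          + h / (N - 1) * sinDelta (modelDelta K N) y) x) ^ (N - 1)

/-- `supp (f dm) ∩ supp (f⁻¹ dm)`, with `m` the Lebesgue measure on `ℝ`. -/
def doubleSupport (f : ℝ → ℝ≥0∞) : Set ℝ :=
  (volume.withDensity f).support ∩ (volume.withDensity (fun x => (f x)⁻¹)).support

/-- The parametric domain of regularity: the pairs `(h, d)` with `0 < d ≤ D` such that
`[-d/2, d/2]` lies in the interior of the double support of `J_{K,N,h}`. -/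
def regularDomain (K : ℝ) (N : WithTop ℝ) (D : ℝ) : Set (ℝ × ℝ) :=
  {p | 0 < p.2 ∧ p.2 ≤ D ∧
    Icc (-(p.2 / 2)) (p.2 / 2) ⊆ interior (doubleSupport (modelDensity K N p.1))}

/-- The model measure `J_{K,N,h} · 1_{[-d/2, d/2]} · m`. -/
def modelMeasure (K : ℝ) (N : WithTop ℝ) (h d : ℝ) : Measure ℝ :=
  volume.withDensity ((Icc (-(d / 2)) (d / 2)).indicator (modelDensity K N h))

/-- The test functions of the Poincaré inequality of `ξ`: nonzero functions in `C_c^∞(ℝ)` with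
mean zero. They are defined on all of `ℝ`, so no boundary condition is imposed at the end points
of the support of `ξ`. -/
def poincareClass (ξ : Measure ℝ) : Set (ℝ → ℝ) :=
  {f | f ≠ 0 ∧ ContDiff ℝ ∞ f ∧ HasCompactSupport f ∧ Integrable f ξ ∧ ∫ x, f x ∂ξ = 0}

open Classical in
/-- The Rayleigh quotient `∫ f'² dξ / ∫ f² dξ`, equal to `+∞` when `∫ f² dξ = 0`. -/
def rayleigh (ξ : Measure ℝ) (f : ℝ → ℝ) : ℝ≥0∞ :=
  if 0 < ∫⁻ x, ENNReal.ofReal (f x ^ 2) ∂ξ then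
    (∫⁻ x, ENNReal.ofReal (deriv f x ^ 2) ∂ξ) / (∫⁻ x, ENNReal.ofReal (f x ^ 2) ∂ξ)
  else ⊤

/-- The Poincaré constant (Neumann spectral gap) of `ξ`. -/
def poincareConstant (ξ : Measure ℝ) : ℝ≥0∞ := ⨅ f ∈ poincareClass ξ, rayleigh ξ f

/-- `λ(h, d)`, the Poincaré constant of the model measure. -/
def spectralGap (K : ℝ) (N : WithTop ℝ) (h d : ℝ) : ℝ≥0∞ :=
  poincareConstant (modelMeasure K N h d)

end

/-!
The spectral gap of a density `J` with Neumann conditions is the lowest Dirichlet eigenvalue of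
the weight `1 / J`: the eigenfunction equation for `f` becomes one for the flux `v = J f'`, which
vanishes at both end points (`IsRootDensity.dirichlet_of_poincare`,
`IsRootDensity.poincare_of_dirichlet`; both directions are Cauchy-Schwarz arguments that need no
eigenfunctions). Conjugation by the square root of `J` turns the latter into the Dirichlet problem
for `-g'' + V g` on `[-d/2, d/2]` with `V = H² / 4 - H' / 2`, where `H` is the logarithmic
derivative of `J` (`IsRootDensity.le_poincareConstant_iff_schrodinger`). Dirichlet test functions
of an interval extend by zero to a larger one, so the gap is non-increasing in `d`
(`spectralGap_anti_length`).

For the model density `H` solves the Riccati equation `H' = -(K + κ H²)` with `H(0) = h` and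
`κ = 1 / (N - 1)`, so `V = K / 2 + (1 / 4 + κ / 2) H²`. The coefficient of `H²` is
`(N + 1) / (4 (N - 1))`, whose sign separates the three cases. It remains to see that the lowest Dirichlet eigenvalue
of `-g'' + H²` grows with `|h|`. By reflection one may take `0 ≤ h₁ < h₂`. The Riccati equation
being autonomous and odd under reflection, either `H₁(x)² ≤ H₂(-x)²` on the whole interval, or
`H₁` and `H₂` are translates of each other and this inequality holds on one side of the midpoint
of the translation (`polarizesBelow_sq_logSlope`). In the second case both problems live on one
line, on two intervals that are mirror images of each other, with one potential that is not larger
on the side of the first interval. Polarization of a nonnegative test function, which moves the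
larger of its values at mirror points to that side, carries test functions of the second interval
to test functions of the first, preserves `∫ g²` and `∫ g'²`, and does not increase the potential
energy (`schrodingerEnergy_polarization_le`). If the coefficient of `H²` is negative, the two
potentials exchange their roles.

To treat `N = ∞` together with finite `N`, the Riccati equation is linearised as `H = z / w` with
`w' = κ z`, `z' = -K w`, which makes sense for `κ = 0`.
-/

noncomputable section

/-! ### Generalised trigonometry -/

lemma cosDelta_zero_right (δ : ℝ) : cosDelta δ 0 = 1 := by
  unfold cosDelta; split_ifs <;> simp

lemma sinDelta_zero_right (δ : ℝ) : sinDelta δ 0 = 0 := by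
  unfold sinDelta; split_ifs <;> simp

lemma cosDelta_neg (δ x : ℝ) : cosDelta δ (-x) = cosDelta δ x := by
  unfold cosDelta; split_ifs <;> simp

lemma sinDelta_neg (δ x : ℝ) : sinDelta δ (-x) = -sinDelta δ x := by
  unfold sinDelta; split_ifs <;> simp [neg_div]

lemma cosDelta_add (δ x y : ℝ) :
    cosDelta δ (x + y) = cosDelta δ x * cosDelta δ y - δ * (sinDelta δ x * sinDelta δ y) := by
  unfold cosDelta sinDelta
  split_ifs with h h'
  · have h1 : √δ ≠ 0 := (Real.sqrt_pos.2 h).ne'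
    have h2 : δ = √δ ^ 2 := (Real.sq_sqrt h.le).symm
    rw [mul_add, Real.cos_add]
    generalize √δ = r at *
    subst h2
    field_simp
  · simp [h']
  · have h0 : 0 < -δ := by have := lt_of_le_of_ne (not_lt.1 h) h'; linarith
    have h1 : √(-δ) ≠ 0 := (Real.sqrt_pos.2 h0).ne'
    have h2 : -δ = √(-δ) ^ 2 := (Real.sq_sqrt h0.le).symm
    rw [mul_add, Real.cosh_add]
    generalize √(-δ) = r at *
    obtain rfl : δ = -r ^ 2 := by linarith
    field_simp
    ring

lemma sinDelta_add (δ x y : ℝ) :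
    sinDelta δ (x + y) = sinDelta δ x * cosDelta δ y + cosDelta δ x * sinDelta δ y := by
  unfold cosDelta sinDelta
  split_ifs with h h'
  · rw [mul_add, Real.sin_add]; ring
  · simp
  · rw [mul_add, Real.sinh_add]; ring

lemma cosDelta_sq_add (δ x : ℝ) : cosDelta δ x ^ 2 + δ * sinDelta δ x ^ 2 = 1 := by
  have := cosDelta_add δ x (-x)
  rw [cosDelta_neg, sinDelta_neg, add_neg_cancel, cosDelta_zero_right] at this
  linarith

lemma hasDerivAt_sinDelta (δ x : ℝ) : HasDerivAt (sinDelta δ) (cosDelta δ x) x := by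
  unfold cosDelta sinDelta
  split_ifs with h h'
  · have h1 : √δ ≠ 0 := (Real.sqrt_pos.2 h).ne'
    convert! (((hasDerivAt_id x).const_mul √δ).sin.div_const √δ) using 1
    simp only [id]
    field_simp
  · exact hasDerivAt_id x
  · have h0 : 0 < -δ := by have := lt_of_le_of_ne (not_lt.1 h) h'; linarith
    have h1 : √(-δ) ≠ 0 := (Real.sqrt_pos.2 h0).ne'
    convert! (((hasDerivAt_id x).const_mul √(-δ)).sinh.div_const √(-δ)) using 1
    simp only [id]
    field_simp

lemma hasDerivAt_cosDelta (δ x : ℝ) : HasDerivAt (cosDelta δ) (-(δ * sinDelta δ x)) x := by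
  unfold cosDelta sinDelta
  split_ifs with h h'
  · have h1 : √δ ≠ 0 := (Real.sqrt_pos.2 h).ne'
    have h2 : δ = √δ ^ 2 := (Real.sq_sqrt h.le).symm
    convert! ((hasDerivAt_id x).const_mul √δ).cos using 1
    simp only [id]
    generalize √δ = r at *
    subst h2
    field_simp
  · simpa [h'] using hasDerivAt_const x (1 : ℝ)
  · have h0 : 0 < -δ := by have := lt_of_le_of_ne (not_lt.1 h) h'; linarith
    have h1 : √(-δ) ≠ 0 := (Real.sqrt_pos.2 h0).ne'
    have h2 : -δ = √(-δ) ^ 2 := (Real.sq_sqrt h0.le).symm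
    convert! ((hasDerivAt_id x).const_mul √(-δ)).cosh using 1
    simp only [id]
    generalize √(-δ) = r at *
    obtain rfl : δ = -r ^ 2 := by linarith
    field_simp

lemma cosDelta_pos_of_nonpos {δ : ℝ} (hδ : δ ≤ 0) (x : ℝ) : 0 < cosDelta δ x := by
  unfold cosDelta
  rw [if_neg hδ.not_gt]
  split_ifs
  · exact one_pos
  · exact Real.cosh_pos _

/-! ### The linear system behind the model density -/

/-- The solution `w` of `w'' = -κK w`, `w(0) = 1`, `w'(0) = κh`. With `κ = 1 / (N - 1)` the model
density is `w ^ (N - 1)`; the value `κ = 0`, for which `w = 1`, stands for `N = ∞`. -/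
def modelBase (K κ h x : ℝ) : ℝ := cosDelta (κ * K) x + κ * h * sinDelta (κ * K) x

/-- The companion `z` of `modelBase`: together they solve `w' = κ z`, `z' = -K w`, with
`w(0) = 1` and `z(0) = h`. Unlike `w' / κ`, it makes sense for `κ = 0`. -/
def modelSlope (K κ h x : ℝ) : ℝ := h * cosDelta (κ * K) x - K * sinDelta (κ * K) x

/-- The logarithmic derivative `H = z / w` of the model density. -/
def logSlope (K κ h x : ℝ) : ℝ := modelSlope K κ h x / modelBase K κ h x

section
variable (K κ h x : ℝ)

lemma modelBase_zero_right : modelBase K κ h 0 = 1 := by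
  simp [modelBase, cosDelta_zero_right, sinDelta_zero_right]

lemma hasDerivAt_modelBase : HasDerivAt (modelBase K κ h) (κ * modelSlope K κ h x) x := by
  convert! (hasDerivAt_cosDelta (κ * K) x).add ((hasDerivAt_sinDelta (κ * K) x).const_mul (κ * h))
    using 1
  simp only [modelSlope]
  ring

lemma hasDerivAt_modelSlope : HasDerivAt (modelSlope K κ h) (-(K * modelBase K κ h x)) x := by
  convert! ((hasDerivAt_cosDelta (κ * K) x).const_mul h).sub
    ((hasDerivAt_sinDelta (κ * K) x).const_mul K) using 1
  simp only [modelBase]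
  ring

lemma continuous_modelBase : Continuous (modelBase K κ h) :=
  continuous_iff_continuousAt.2 fun x => (hasDerivAt_modelBase K κ h x).continuousAt

lemma continuous_modelSlope : Continuous (modelSlope K κ h) :=
  continuous_iff_continuousAt.2 fun x => (hasDerivAt_modelSlope K κ h x).continuousAt

lemma modelBase_neg : modelBase K κ h (-x) = modelBase K κ (-h) x := by
  simp [modelBase, cosDelta_neg, sinDelta_neg]

lemma modelSlope_neg : modelSlope K κ h (-x) = -modelSlope K κ (-h) x := by
  simp [modelSlope, cosDelta_neg, sinDelta_neg]
  ring

lemma logSlope_neg : logSlope K κ h (-x) = -logSlope K κ (-h) x := by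
  simp [logSlope, modelBase_neg, modelSlope_neg, neg_div]

variable {x} in
/-- The Riccati equation for the logarithmic derivative. -/
lemma hasDerivAt_logSlope (hw : modelBase K κ h x ≠ 0) :
    HasDerivAt (logSlope K κ h) (-(K + κ * logSlope K κ h x ^ 2)) x := by
  convert! (hasDerivAt_modelSlope K κ h x).div (hasDerivAt_modelBase K κ h x) hw using 1
  simp only [logSlope]
  field_simp
  ring

end

/-- The determinant of two solutions of the system at two points depends on the difference of the
points only, the system being autonomous and trace free. -/
lemma model_det (K κ h₁ h₂ x y : ℝ) :
    modelSlope K κ h₁ x * modelBase K κ h₂ y - modelSlope K κ h₂ y * modelBase K κ h₁ x =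
      (h₁ - h₂) * cosDelta (κ * K) (x - y) - (K + κ * (h₁ * h₂)) * sinDelta (κ * K) (x - y) := by
  rw [sub_eq_add_neg x y, cosDelta_add, sinDelta_add, cosDelta_neg, sinDelta_neg]
  simp only [modelSlope, modelBase]
  ring

/-! ### Comparing the potentials of two model densities -/

/-- The potentials `Q₁` and `Q₂` on `[-L, L]` become, after translating the interval, restrictions
of one function, which takes at every point on one side of the midpoint of the two intervals a value
not above its value at the mirror point. For `|τ| > 2 * L` the intervals are disjoint, and the
relation says that `Q₁ x ≤ Q₂ (-x)` on `[-L, L]`. -/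
def PolarizesBelow (L : ℝ) (Q₁ Q₂ : ℝ → ℝ) : Prop :=
  ∃ τ : ℝ, (∀ x ∈ Icc (-L) L, x + τ ∈ Icc (-L) L → Q₁ (x + τ) = Q₂ x) ∧
    ((0 ≤ τ ∧ ∀ x ∈ Icc (-L) L, x ≤ τ / 2 → Q₁ x ≤ Q₂ (-x)) ∨
      (τ ≤ 0 ∧ ∀ x ∈ Icc (-L) L, τ / 2 ≤ x → Q₁ x ≤ Q₂ (-x)))

lemma neg_mem_Icc_neg_self {L x : ℝ} (hx : x ∈ Icc (-L) L) : -x ∈ Icc (-L) L :=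
  ⟨by linarith [hx.2], by linarith [hx.1]⟩

lemma PolarizesBelow.affine {L : ℝ} {Q₁ Q₂ : ℝ → ℝ} (h : PolarizesBelow L Q₁ Q₂) {α : ℝ}
    (hα : 0 ≤ α) (β : ℝ) :
    PolarizesBelow L (fun x => β + α * Q₁ x) (fun x => β + α * Q₂ x) := by
  obtain ⟨τ, h1, h2⟩ := h
  refine ⟨τ, fun x hx hx' => by simp only [h1 x hx hx'], ?_⟩
  refine h2.imp (fun h => ⟨h.1, fun x hx hx' => ?_⟩) (fun h => ⟨h.1, fun x hx hx' => ?_⟩) <;>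
  · have := h.2 x hx hx'
    exact add_le_add le_rfl (mul_le_mul_of_nonneg_left this hα)

/-- Multiplication by a nonpositive constant exchanges the roles of the two potentials. -/
lemma PolarizesBelow.affine_of_nonpos {L : ℝ} {Q₁ Q₂ : ℝ → ℝ} (h : PolarizesBelow L Q₁ Q₂) {α : ℝ}
    (hα : α ≤ 0) (β : ℝ) :
    PolarizesBelow L (fun x => β + α * Q₂ x) (fun x => β + α * Q₁ x) := by
  obtain ⟨τ, h1, h2⟩ := h
  refine ⟨-τ, fun x hx hx' => ?_, ?_⟩
  · have := h1 (x + -τ) hx' (by simpa using hx)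
    simp only [neg_add_cancel_right] at this
    simp only [this]
  · have key : ∀ x, Q₁ (-x) ≤ Q₂ (- -x) → β + α * Q₂ x ≤ β + α * Q₁ (-x) := fun x hx => by
      rw [neg_neg] at hx
      linarith [mul_le_mul_of_nonpos_left hx hα]
    rcases h2 with ⟨h0, h2⟩ | ⟨h0, h2⟩
    · exact Or.inr ⟨by linarith, fun x hx hx' =>
        key x (h2 (-x) (neg_mem_Icc_neg_self hx) (by linarith))⟩
    · exact Or.inl ⟨by linarith, fun x hx hx' =>
        key x (h2 (-x) (neg_mem_Icc_neg_self hx) (by linarith))⟩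

section
variable {K κ h L : ℝ}

/-- If `w` is positive on the symmetric interval `[-L, L]`, then `κ h` times the generalised tangent
is less than one in absolute value there. -/
lemma abs_mul_sinDelta_lt (hw : ∀ x ∈ Icc (-L) L, 0 < modelBase K κ h x) {x : ℝ}
    (hx : x ∈ Icc (-L) L) : |κ * h * sinDelta (κ * K) x| < cosDelta (κ * K) x := by
  have h1 := hw x hx
  have h2 := hw (-x) (neg_mem_Icc_neg_self hx)
  simp only [modelBase, cosDelta_neg, sinDelta_neg] at h1 h2
  exact abs_lt.2 ⟨by linarith, by linarith⟩

lemma cosDelta_pos_of_modelBase_pos (hw : ∀ x ∈ Icc (-L) L, 0 < modelBase K κ h x) {x : ℝ}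
    (hx : x ∈ Icc (-L) L) : 0 < cosDelta (κ * K) x :=
  (abs_nonneg _).trans_lt (abs_mul_sinDelta_lt hw hx)

lemma strictMonoOn_tanDelta (hw : ∀ x ∈ Icc (-L) L, 0 < modelBase K κ h x) :
    StrictMonoOn (fun x => sinDelta (κ * K) x / cosDelta (κ * K) x) (Icc (-L) L) := by
  have hc := fun x hx => cosDelta_pos_of_modelBase_pos hw (x := x) hx
  have hd : ∀ x ∈ Icc (-L) L, HasDerivAt (fun x => sinDelta (κ * K) x / cosDelta (κ * K) x)
      (1 / cosDelta (κ * K) x ^ 2) x := fun x hx => by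
    convert! (hasDerivAt_sinDelta (κ * K) x).div (hasDerivAt_cosDelta (κ * K) x) (hc x hx).ne'
      using 1
    rw [← cosDelta_sq_add (κ * K) x]
    ring
  refine strictMonoOn_of_deriv_pos (convex_Icc _ _)
    (fun x hx => (hd x hx).continuousAt.continuousWithinAt) fun x hx => ?_
  rw [interior_Icc] at hx
  rw [(hd x (Ioo_subset_Icc_self hx)).deriv]
  have := hc x (Ioo_subset_Icc_self hx)
  positivity

end

section
variable {K κ h₁ h₂ L : ℝ}

lemma sq_logSlope_le_of_det_nonpos (h₁₀ : 0 ≤ h₁) (h₂₀ : 0 ≤ h₂) {x : ℝ}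
    (hw₁ : 0 < modelBase K κ h₁ x) (hw₂ : 0 < modelBase K κ h₂ (-x))
    (hf : modelSlope K κ h₁ x * modelBase K κ h₂ (-x)
      - modelSlope K κ h₂ (-x) * modelBase K κ h₁ x ≤ 0) :
    logSlope K κ h₁ x ^ 2 ≤ logSlope K κ h₂ (-x) ^ 2 := by
  have hsum : 0 ≤ modelSlope K κ h₁ x * modelBase K κ h₂ (-x)
      + modelSlope K κ h₂ (-x) * modelBase K κ h₁ x := by
    have := model_det K κ h₁ (-h₂) x x
    rw [sub_self, cosDelta_zero_right, sinDelta_zero_right, ← modelBase_neg] at this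
    have h3 := modelSlope_neg K κ h₂ x
    rw [h3]
    linarith
  simp only [logSlope]
  rw [div_pow, div_pow, div_le_div_iff₀ (by positivity) (by positivity)]
  nlinarith [mul_nonpos_of_nonpos_of_nonneg hf hsum]

/-- The bound that keeps the difference of two points of `[-L, L]`, one of them a zero of the
determinant, within the range where the generalised cosine is positive. -/
lemma cosDelta_sub_pos_of_det_eq_zero (h₁₀ : 0 ≤ h₁) (h₁₂ : h₁ < h₂)
    (hw₂ : ∀ x ∈ Icc (-L) L, 0 < modelBase K κ h₂ x) {s x : ℝ}
    (hs : s ∈ Icc (-L) L) (hx : x ∈ Icc (-L) L)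
    (hf : modelSlope K κ h₁ s * modelBase K κ h₂ (-s)
      - modelSlope K κ h₂ (-s) * modelBase K κ h₁ s = 0) :
    0 < cosDelta (κ * K) (s - x) := by
  rcases le_or_gt (κ * K) 0 with hδ | hδ
  · exact cosDelta_pos_of_nonpos hδ _
  have hcs := cosDelta_pos_of_modelBase_pos hw₂ hs
  have hcx := cosDelta_pos_of_modelBase_pos hw₂ hx
  have hts := abs_mul_sinDelta_lt hw₂ hs
  have htx := abs_mul_sinDelta_lt hw₂ hx
  rw [model_det, sub_neg_eq_add, cosDelta_add, sinDelta_add] at hf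
  rw [sub_eq_add_neg, cosDelta_add, cosDelta_neg, sinDelta_neg]
  generalize cosDelta (κ * K) s = cs at *
  generalize cosDelta (κ * K) x = cx at *
  generalize sinDelta (κ * K) s = ss at *
  generalize sinDelta (κ * K) x = sx at *
  have h₂₀ : 0 < h₂ := h₁₀.trans_lt h₁₂
  have hκ : 0 < |κ| := abs_pos.2 fun h => by simp [h] at hδ
  rw [abs_mul, abs_mul, abs_of_pos h₂₀] at hts htx
  -- The equation for a zero, in absolute values, with `δ = κ K`.
  have key : |κ| * (h₂ - h₁) * |cs ^ 2 - κ * K * ss ^ 2|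
      = 2 * (κ * K + κ ^ 2 * (h₁ * h₂)) * |ss| * cs := by
    have h1 : κ * (h₂ - h₁) * (cs ^ 2 - κ * K * ss ^ 2)
        = -(2 * (κ * K + κ ^ 2 * (h₁ * h₂)) * ss * cs) := by linear_combination (-κ) * hf
    have h2 := congrArg abs h1
    rw [abs_neg] at h2
    simp only [abs_mul] at h2
    rw [abs_of_pos (sub_pos.2 h₁₂), abs_of_pos hcs, abs_two,
      abs_of_pos (by positivity : 0 < κ * K + κ ^ 2 * (h₁ * h₂))] at h2
    exact h2
  have hss : |ss| ^ 2 = ss ^ 2 := sq_abs ss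
  set δ := κ * K
  have hP : 0 ≤ κ ^ 2 * (h₁ * h₂) * (|ss| * cs) := by positivity
  have hle : |κ| * (h₂ - h₁) ≤ |κ| * h₂ := by nlinarith
  -- The tangent of a zero is at most `|κ| h₂ / (2 δ)` in absolute value.
  have hr : 2 * δ * |ss| ≤ |κ| * h₂ * cs := by
    rcases le_or_gt (δ * ss ^ 2) (cs ^ 2) with hcase | hcase
    · rw [abs_of_nonneg (sub_nonneg.2 hcase)] at key
      have h3 : |κ| * (h₂ - h₁) * (cs ^ 2 - δ * ss ^ 2) ≤ |κ| * h₂ * cs ^ 2 := by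
        have : cs ^ 2 - δ * ss ^ 2 ≤ cs ^ 2 := by nlinarith [sq_nonneg ss]
        exact mul_le_mul hle this (by linarith) (by positivity)
      refine le_of_mul_le_mul_right ?_ hcs
      nlinarith
    · exfalso
      rw [abs_of_neg (sub_neg.2 hcase)] at key
      have hss0 : 0 < |ss| := abs_pos.2 fun h => by
        rw [h] at hcase; nlinarith
      have h3 : |κ| * (h₂ - h₁) * -(cs ^ 2 - δ * ss ^ 2) ≤ |κ| * h₂ * (δ * |ss| ^ 2) := by
        rw [hss]
        exact mul_le_mul hle (by nlinarith) (by linarith) (by positivity)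
      have h4 : |κ| * h₂ * |ss| * (δ * |ss|) < cs * (δ * |ss|) :=
        mul_lt_mul_of_pos_right hts (by positivity)
      have h5 : 0 < δ * |ss| * cs := by positivity
      nlinarith
  have h6 : 2 * δ * (|ss| * |sx|) < 2 * (cs * cx) := by
    have h7 : 2 * δ * |ss| * |sx| ≤ |κ| * h₂ * cs * |sx| :=
      mul_le_mul_of_nonneg_right hr (abs_nonneg _)
    have h8 : |κ| * h₂ * |sx| * cs < cx * cs := mul_lt_mul_of_pos_right htx hcs
    have h9 : 0 < cs * cx := by positivity
    nlinarith
  have h10 : -(|ss| * |sx|) ≤ ss * sx := by rw [← abs_mul]; exact neg_abs_le _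
  nlinarith

/-- The determinant is negative at the origin. If it vanishes at `s`, it is nonpositive on the whole
part of the interval that lies on the origin's side of `s`. -/
lemma det_nonpos_of_det_eq_zero (h₁₀ : 0 ≤ h₁) (h₁₂ : h₁ < h₂)
    (hw₂ : ∀ x ∈ Icc (-L) L, 0 < modelBase K κ h₂ x) {s x : ℝ}
    (hs : s ∈ Icc (-L) L) (hx : x ∈ Icc (-L) L)
    (hf : modelSlope K κ h₁ s * modelBase K κ h₂ (-s)
      - modelSlope K κ h₂ (-s) * modelBase K κ h₁ s = 0)
    (hxs : 0 ≤ s * (s - x)) :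
    modelSlope K κ h₁ x * modelBase K κ h₂ (-x)
      - modelSlope K κ h₂ (-x) * modelBase K κ h₁ x ≤ 0 := by
  have hL : (0 : ℝ) ∈ Icc (-L) L := ⟨by linarith [hs.1, hs.2], by linarith [hs.1, hs.2]⟩
  have hcp := cosDelta_sub_pos_of_det_eq_zero h₁₀ h₁₂ hw₂ hs hx hf
  have hcs := cosDelta_pos_of_modelBase_pos hw₂ hs
  have hcx := cosDelta_pos_of_modelBase_pos hw₂ hx
  have hmono := strictMonoOn_tanDelta hw₂
  have ht0 : (fun x => sinDelta (κ * K) x / cosDelta (κ * K) x) 0 = 0 := by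
    simp [sinDelta_zero_right]
  have hs0 : s ≠ 0 := by
    rintro rfl
    rw [model_det] at hf
    simp only [neg_zero, sub_zero, cosDelta_zero_right, sinDelta_zero_right] at hf
    linarith
  rw [model_det, sub_neg_eq_add] at hf ⊢
  have hid : ((h₁ - h₂) * cosDelta (κ * K) (x + x)
        - (K + κ * (h₁ * h₂)) * sinDelta (κ * K) (x + x))
        * (sinDelta (κ * K) s * cosDelta (κ * K) s)
      = (h₁ - h₂) * (sinDelta (κ * K) (s - x) * cosDelta (κ * K) (s - x)) := by
    rw [sub_eq_add_neg s x]
    simp only [cosDelta_add, sinDelta_add, cosDelta_neg, sinDelta_neg] at hf ⊢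
    linear_combination (sinDelta (κ * K) x * cosDelta (κ * K) x) * hf
  have hsub : sinDelta (κ * K) (s - x) = cosDelta (κ * K) s * cosDelta (κ * K) x *
      (sinDelta (κ * K) s / cosDelta (κ * K) s - sinDelta (κ * K) x / cosDelta (κ * K) x) := by
    rw [sub_eq_add_neg s x, sinDelta_add, cosDelta_neg, sinDelta_neg]
    field_simp
    ring
  have hsin : sinDelta (κ * K) s
      = cosDelta (κ * K) s * (sinDelta (κ * K) s / cosDelta (κ * K) s) := by
    field_simp
  rcases lt_or_gt_of_ne hs0 with hneg | hpos
  · have h1 : s - x ≤ 0 := by nlinarith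
    have h2 := hmono.monotoneOn hs hx (by linarith)
    have h3 := hmono hs hL hneg
    rw [ht0] at h3
    simp only at h2 h3
    have h4 : sinDelta (κ * K) (s - x) ≤ 0 := by
      rw [hsub]
      exact mul_nonpos_of_nonneg_of_nonpos (by positivity) (by linarith)
    have h5 : sinDelta (κ * K) s * cosDelta (κ * K) s < 0 := by
      rw [hsin]
      exact mul_neg_of_neg_of_pos (mul_neg_of_pos_of_neg hcs h3) hcs
    by_contra hcon
    have h6 := mul_neg_of_pos_of_neg (not_le.1 hcon) h5
    rw [hid] at h6
    have h7 := mul_nonneg_of_nonpos_of_nonpos (by linarith : h₁ - h₂ ≤ 0)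
      (mul_nonpos_of_nonpos_of_nonneg h4 hcp.le)
    linarith
  · have h1 : 0 ≤ s - x := by nlinarith
    have h2 := hmono.monotoneOn hx hs (by linarith)
    have h3 := hmono hL hs hpos
    rw [ht0] at h3
    simp only at h2 h3
    have h4 : 0 ≤ sinDelta (κ * K) (s - x) := by
      rw [hsub]
      exact mul_nonneg (by positivity) (by linarith)
    have h5 : 0 < sinDelta (κ * K) s * cosDelta (κ * K) s := by
      rw [hsin]
      exact mul_pos (mul_pos hcs h3) hcs
    by_contra hcon
    have h6 := mul_pos (not_le.1 hcon) h5
    rw [hid] at h6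
    have h7 := mul_nonpos_of_nonpos_of_nonneg (by linarith : h₁ - h₂ ≤ 0) (mul_nonneg h4 hcp.le)
    linarith

/-- The squared logarithmic derivatives of two model densities are comparable. -/
lemma polarizesBelow_sq_logSlope (h₁₀ : 0 ≤ h₁) (h₁₂ : h₁ < h₂)
    (hw₁ : ∀ x ∈ Icc (-L) L, 0 < modelBase K κ h₁ x)
    (hw₂ : ∀ x ∈ Icc (-L) L, 0 < modelBase K κ h₂ x) :
    PolarizesBelow L (fun x => logSlope K κ h₁ x ^ 2) (fun x => logSlope K κ h₂ x ^ 2) := by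
  rcases lt_or_ge L 0 with hL | hL
  · exact ⟨0, fun x hx => by linarith [hx.1, hx.2], Or.inl ⟨le_rfl, fun x hx => by
      linarith [hx.1, hx.2]⟩⟩
  have h₂₀ := h₁₀.trans h₁₂.le
  set f : ℝ → ℝ := fun x => modelSlope K κ h₁ x * modelBase K κ h₂ (-x)
      - modelSlope K κ h₂ (-x) * modelBase K κ h₁ x with hf
  have hle : ∀ x ∈ Icc (-L) L, f x ≤ 0 → logSlope K κ h₁ x ^ 2 ≤ logSlope K κ h₂ (-x) ^ 2 :=
    fun x hx => sq_logSlope_le_of_det_nonpos h₁₀ h₂₀ (hw₁ x hx) (hw₂ _ (neg_mem_Icc_neg_self hx))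
  by_cases hall : ∀ x ∈ Icc (-L) L, f x ≤ 0
  · refine ⟨2 * L + 1, fun x hx hx' => ?_, Or.inl ⟨by linarith, fun x hx _ => hle x hx (hall x hx)⟩⟩
    linarith [hx.1, hx'.2]
  push Not at hall
  obtain ⟨y, hy, hfy⟩ := hall
  have hcont : Continuous f := by
    have := continuous_modelBase K κ h₁
    have := continuous_modelBase K κ h₂
    have := continuous_modelSlope K κ h₁
    have := continuous_modelSlope K κ h₂
    fun_prop
  have hf0 : f 0 = h₁ - h₂ := by
    simp [hf, model_det, cosDelta_zero_right, sinDelta_zero_right]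
  obtain ⟨s, hsy, hfs⟩ : ∃ s ∈ uIcc 0 y, f s = 0 :=
    intermediate_value_uIcc hcont.continuousOn (by
      rw [hf0, mem_uIcc]; exact Or.inl ⟨by linarith, hfy.le⟩)
  have hs : s ∈ Icc (-L) L := uIcc_subset_Icc ⟨by linarith, hL⟩ hy hsy
  refine ⟨2 * s, fun x hx hx' => ?_, ?_⟩
  · -- By autonomy the determinant vanishes at `(x + 2 s, x)` as it does at `(s, -s)`.
    have h1 := model_det K κ h₁ h₂ (x + 2 * s) x
    have h2 := model_det K κ h₁ h₂ s (-s)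
    rw [show x + 2 * s - x = s - -s by ring, ← h2] at h1
    simp only [hf] at hfs
    rw [hfs] at h1
    simp only [logSlope]
    rw [(div_eq_div_iff (hw₁ _ hx').ne' (hw₂ _ hx).ne').2 (sub_eq_zero.1 h1)]
  · rcases le_total 0 s with h0 | h0
    · exact Or.inl ⟨by linarith, fun x hx hxs => hle x hx
        (det_nonpos_of_det_eq_zero h₁₀ h₁₂ hw₂ hs hx hfs
          (mul_nonneg h0 (by linarith)))⟩
    · exact Or.inr ⟨by linarith, fun x hx hxs => hle x hx
        (det_nonpos_of_det_eq_zero h₁₀ h₁₂ hw₂ hs hx hfs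
          (mul_nonneg_of_nonpos_of_nonpos h0 (by linarith)))⟩

end

/-! ### Dirichlet forms and polarization -/

/-- Test functions for the Dirichlet problem on `[-L, L]`: Lipschitz functions on the line that
vanish outside the interval. This class is stable under `max` and `min`. -/
def IsDirichletTest (L : ℝ) (g : ℝ → ℝ) : Prop :=
  (∃ C, LipschitzWith C g) ∧ ∀ x ∉ Icc (-L) L, g x = 0

/-- The energy `∫ g'² + V g²` of the Schrödinger operator `-g'' + V g`. -/
def schrodingerEnergy (V g : ℝ → ℝ) : ℝ := ∫ x, (deriv g x ^ 2 + V x * g x ^ 2)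

section
variable {L : ℝ} {g V : ℝ → ℝ}

lemma IsDirichletTest.deriv_eq_zero (hg : IsDirichletTest L g) {x : ℝ} (hx : x ∉ Icc (-L) L) :
    deriv g x = 0 := by
  have : g =ᶠ[𝓝 x] fun _ => 0 := by
    filter_upwards [isClosed_Icc.isOpen_compl.mem_nhds hx] with y hy using hg.2 y hy
  rw [this.deriv_eq, deriv_const]

lemma IsDirichletTest.comp_neg (hg : IsDirichletTest L g) :
    IsDirichletTest L fun x => g (-x) := by
  obtain ⟨⟨C, hC⟩, h0⟩ := hg
  refine ⟨⟨C, fun x y => ?_⟩, fun x hx => h0 _ fun h => hx ?_⟩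
  · simpa using hC (-x) (-y)
  · simpa using neg_mem_Icc_neg_self h

lemma IsDirichletTest.abs (hg : IsDirichletTest L g) : IsDirichletTest L fun x => |g x| := by
  obtain ⟨⟨C, hC⟩, h0⟩ := hg
  refine ⟨⟨C, ?_⟩, fun x hx => by simp [h0 x hx]⟩
  refine LipschitzWith.of_dist_le_mul fun x y => ?_
  refine le_trans ?_ (hC.dist_le_mul x y)
  simpa only [Real.dist_eq] using abs_abs_sub_abs_le (g x) (g y)

lemma IsDirichletTest.mono {L' : ℝ} (hL : L ≤ L') (hg : IsDirichletTest L g) :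
    IsDirichletTest L' g :=
  ⟨hg.1, fun x hx => hg.2 x fun h => hx ⟨by linarith [h.1], by linarith [h.2]⟩⟩

lemma IsDirichletTest.continuous (hg : IsDirichletTest L g) : Continuous g :=
  hg.1.choose_spec.continuous

/-- A function that is continuous on a compact interval and vanishes outside is integrable. -/
lemma integrable_of_continuousOn_of_eq_zero {f : ℝ → ℝ} (hf : ContinuousOn f (Icc (-L) L))
    (h0 : ∀ x ∉ Icc (-L) L, f x = 0) : Integrable f := by
  refine (integrableOn_iff_integrable_of_support_subset (s := Icc (-L) L) fun x hx => ?_).1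
    hf.integrableOn_Icc
  by_contra h
  exact hx (h0 x h)

lemma IsDirichletTest.integrable_deriv_sq (hg : IsDirichletTest L g) :
    Integrable fun x => deriv g x ^ 2 := by
  obtain ⟨C, hC⟩ := hg.1
  refine (integrableOn_iff_integrable_of_support_subset (s := Icc (-L) L) fun x hx => ?_).1 ?_
  · by_contra h
    exact hx (by simp [hg.deriv_eq_zero h])
  · refine Measure.integrableOn_of_bounded (M := (C : ℝ) ^ 2) (by simp)
      ((measurable_deriv g).pow_const 2).aestronglyMeasurable (ae_of_all _ fun x => ?_)
    rw [norm_pow]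
    gcongr
    exact norm_deriv_le_of_lipschitz hC

lemma IsDirichletTest.integrable_mul_sq (hg : IsDirichletTest L g)
    (hV : ContinuousOn V (Icc (-L) L)) : Integrable fun x => V x * g x ^ 2 :=
  integrable_of_continuousOn_of_eq_zero (hV.mul (hg.continuous.continuousOn.pow 2))
    fun x hx => by simp [hg.2 x hx]

lemma IsDirichletTest.integrable_energy (hg : IsDirichletTest L g)
    (hV : ContinuousOn V (Icc (-L) L)) : Integrable fun x => deriv g x ^ 2 + V x * g x ^ 2 :=
  hg.integrable_deriv_sq.add (hg.integrable_mul_sq hV)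

lemma schrodingerEnergy_comp_neg (V g : ℝ → ℝ) :
    schrodingerEnergy (fun x => V (-x)) (fun x => g (-x)) = schrodingerEnergy V g := by
  unfold schrodingerEnergy
  rw [← integral_neg_eq_self fun x => deriv g x ^ 2 + V x * g x ^ 2]
  congr with x
  rw [deriv_comp_neg, neg_sq]

end

/-- At a zero of `u` where `|u|` is differentiable, both derivatives vanish. -/
lemma deriv_abs_sq {u : ℝ → ℝ} {x : ℝ} (hu : DifferentiableAt ℝ u x)
    (hau : DifferentiableAt ℝ (fun y => |u y|) x) :
    deriv (fun y => |u y|) x ^ 2 = deriv u x ^ 2 := by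
  by_cases h0 : u x = 0
  · have h1 : deriv (fun y => |u y|) x = 0 := by
      refine IsLocalMin.deriv_eq_zero (Eventually.of_forall fun y => ?_)
      simp [h0]
    have h2 := hau.hasDerivAt
    rw [h1, hasDerivAt_iff_isLittleO] at h2
    have h3 : HasDerivAt u 0 x := by
      rw [hasDerivAt_iff_isLittleO]
      refine (Asymptotics.isLittleO_norm_left.1 ?_)
      simpa [h0] using h2
    rw [h1, h3.deriv]
  · have h1 : HasDerivAt (fun y => |u y| ^ 2) (2 * |u x| * deriv (fun y => |u y|) x) x := by
      convert! hau.hasDerivAt.fun_pow 2 using 1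
      norm_num
    have h2 : HasDerivAt (fun y => |u y| ^ 2) (2 * u x * deriv u x) x := by
      simp only [sq_abs]
      convert! hu.hasDerivAt.fun_pow 2 using 1
      norm_num
    have h3 := congrArg (fun t => t ^ 2) (h1.unique h2)
    simp only [mul_pow, sq_abs] at h3
    have h4 : (2 : ℝ) ^ 2 * u x ^ 2 ≠ 0 := by positivity
    exact mul_left_cancel₀ h4 h3

lemma schrodingerEnergy_abs {L : ℝ} {g : ℝ → ℝ} (hg : IsDirichletTest L g) (V : ℝ → ℝ) :
    schrodingerEnergy V (fun x => |g x|) = schrodingerEnergy V g := by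
  obtain ⟨C, hC⟩ := hg.1
  obtain ⟨C', hC'⟩ := hg.abs.1
  refine integral_congr_ae ?_
  filter_upwards [hC.ae_differentiableAt_real, hC'.ae_differentiableAt_real] with x hx hx'
  simp only [deriv_abs_sq hx hx', sq_abs]

/-- Maximum and minimum together have the same squared derivatives as the two functions. -/
lemma deriv_max_sq_add_deriv_min_sq {a b : ℝ → ℝ} {x : ℝ} (ha : DifferentiableAt ℝ a x)
    (hb : DifferentiableAt ℝ b x) (hab : DifferentiableAt ℝ (fun y => |a y - b y|) x) :
    deriv (fun y => max (a y) (b y)) x ^ 2 + deriv (fun y => min (a y) (b y)) x ^ 2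
      = deriv a x ^ 2 + deriv b x ^ 2 := by
  have h1 := deriv_abs_sq (u := fun y => a y - b y) (ha.sub hb) hab
  have h2 : deriv (fun y => a y - b y) x = deriv a x - deriv b x := deriv_fun_sub ha hb
  have hmax : HasDerivAt (fun y => max (a y) (b y))
      ((deriv a x + deriv b x + deriv (fun y => |a y - b y|) x) / 2) x := by
    convert! ((ha.hasDerivAt.add hb.hasDerivAt).add hab.hasDerivAt).div_const 2 using 1
    funext y
    rcases le_total (a y) (b y) with h | h
    · simp [max_eq_right h, abs_of_nonpos (sub_nonpos.2 h)]
      ring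
    · simp [max_eq_left h, abs_of_nonneg (sub_nonneg.2 h)]
  have hmin : HasDerivAt (fun y => min (a y) (b y))
      ((deriv a x + deriv b x - deriv (fun y => |a y - b y|) x) / 2) x := by
    convert! ((ha.hasDerivAt.add hb.hasDerivAt).sub hab.hasDerivAt).div_const 2 using 1
    funext y
    rcases le_total (a y) (b y) with h | h
    · simp [min_eq_left h, abs_of_nonpos (sub_nonpos.2 h)]
      ring
    · simp [min_eq_right h, abs_of_nonneg (sub_nonneg.2 h)]
  rw [hmax.deriv, hmin.deriv]
  rw [h2] at h1
  linear_combination h1 / 2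

lemma lipschitzWith_ite_lt {C : NNReal} {f₁ f₂ : ℝ → ℝ} (h₁ : LipschitzWith C f₁)
    (h₂ : LipschitzWith C f₂) {c : ℝ} (hc : f₁ c = f₂ c) :
    LipschitzWith C fun x => if x < c then f₁ x else f₂ x := by
  have key : ∀ x y, x ≤ y → dist (if x < c then f₁ x else f₂ x) (if y < c then f₁ y else f₂ y)
      ≤ C * dist x y := fun x y hxy => by
    split_ifs with hx hy hy
    · exact h₁.dist_le_mul x y
    · refine (dist_triangle _ (f₁ c) _).trans ?_
      have e1 := h₁.dist_le_mul x c
      have e2 := h₂.dist_le_mul c y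
      rw [← hc] at e2
      rw [Real.dist_eq x c, abs_of_nonpos (by linarith)] at e1
      rw [Real.dist_eq c y, abs_of_nonpos (by linarith)] at e2
      rw [Real.dist_eq x y, abs_of_nonpos (by linarith)]
      linarith
    · exact absurd (hxy.trans_lt hy) hx
    · exact h₂.dist_le_mul x y
  refine LipschitzWith.of_dist_le_mul fun x y => ?_
  rcases le_total x y with h | h
  · exact key x y h
  · rw [dist_comm, dist_comm x y]
    exact key y x h

/-- The polarization of `g`, in the coordinate of the translated interval. With the two intervals
placed on one line such that they are mirror images about `τ / 2`, it moves the larger one of the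
two values of `g` at mirror points to the left of `τ / 2` and the smaller one to the right. -/
def polarization (τ : ℝ) (g : ℝ → ℝ) (x : ℝ) : ℝ :=
  if x < τ / 2 then max (g (x - τ)) (g (-x)) else min (g (x - τ)) (g (-x))

section
variable {L τ : ℝ} {g V₁ V₂ : ℝ → ℝ}

lemma IsDirichletTest.polarization (hτ : 0 ≤ τ) (hg : IsDirichletTest L g) (hg0 : ∀ x, 0 ≤ g x) :
    IsDirichletTest L (polarization τ g) := by
  obtain ⟨C, hC⟩ := hg.1
  have ha : LipschitzWith C fun x => g (x - τ) := fun x y => by simpa using hC (x - τ) (y - τ)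
  have hb : LipschitzWith C fun x => g (-x) := fun x y => by simpa using hC (-x) (-y)
  refine ⟨⟨C, ?_⟩, fun x hx => ?_⟩
  · refine lipschitzWith_ite_lt (by simpa using ha.max hb) (by simpa using ha.min hb) ?_
    have : τ / 2 - τ = -(τ / 2) := by ring
    simp [this]
  · have hb0 : g (-x) = 0 := hg.2 _ fun h => hx (by simpa using neg_mem_Icc_neg_self h)
    unfold _root_.polarization
    split_ifs with h
    · have ha0 : g (x - τ) = 0 := hg.2 _ fun h' => hx ⟨by linarith [h'.1], by linarith [h'.1]⟩
      simp [ha0, hb0]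
    · simp [hb0, hg0]

lemma schrodingerEnergy_polarization_le (hτ : 0 ≤ τ) (hg : IsDirichletTest L g)
    (hg0 : ∀ x, 0 ≤ g x) (hV₁ : ContinuousOn V₁ (Icc (-L) L)) (hV₂ : ContinuousOn V₂ (Icc (-L) L))
    (htrans : ∀ x ∈ Icc (-L) L, x + τ ∈ Icc (-L) L → V₁ (x + τ) = V₂ x)
    (hle : ∀ x ∈ Icc (-L) L, x ≤ τ / 2 → V₁ x ≤ V₂ (-x)) :
    schrodingerEnergy V₁ (polarization τ g) ≤ schrodingerEnergy V₂ g := by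
  have hG := hg.polarization hτ hg0
  set G := polarization τ g with hGdef
  set e₁ : ℝ → ℝ := fun x => deriv G x ^ 2 + V₁ x * G x ^ 2 with he₁
  set e₂ : ℝ → ℝ := fun x => deriv g x ^ 2 + V₂ x * g x ^ 2 with he₂
  have hi₁ : Integrable e₁ := hG.integrable_energy hV₁
  have hi₂ : Integrable e₂ := hg.integrable_energy hV₂
  obtain ⟨C, hC⟩ := hg.1
  set a : ℝ → ℝ := fun x => g (x - τ) with ha
  set b : ℝ → ℝ := fun x => g (-x) with hb
  have hLa : LipschitzWith C a := fun x y => by simpa [ha] using hC (x - τ) (y - τ)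
  have hLb : LipschitzWith C b := fun x y => by simpa [hb] using hC (-x) (-y)
  have hLab : LipschitzWith (C + C) fun y => |a y - b y| :=
    LipschitzWith.of_dist_le_mul fun x y => by
      refine le_trans ?_ ((hLa.sub hLb).dist_le_mul x y)
      simpa only [Real.dist_eq] using abs_abs_sub_abs_le _ _
  -- The inequality holds between mirror points on the left of `τ / 2` ...
  have hleft : ∀ᵐ x, x < τ / 2 → e₁ x + e₁ (τ - x) ≤ e₂ (x - τ) + e₂ (-x) := by
    filter_upwards [hLa.ae_differentiableAt_real, hLb.ae_differentiableAt_real,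
      hLab.ae_differentiableAt_real] with x hxa hxb hxab hx
    have hd := deriv_max_sq_add_deriv_min_sq hxa hxb hxab
    have hd1 : deriv G x = deriv (fun y => max (a y) (b y)) x := by
      refine Filter.EventuallyEq.deriv_eq ?_
      filter_upwards [gt_mem_nhds hx] with y hy
      simp [hGdef, polarization, hy, ha, hb]
    have hGr : ∀ y, y < τ / 2 → G (τ - y) = min (a y) (b y) := fun y hy => by
      have h1 : ¬ τ - y < τ / 2 := by linarith
      simp only [hGdef, polarization, h1, if_false, ha, hb, sub_sub_cancel_left, neg_sub]
      exact min_comm _ _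
    have hd2 : deriv G (τ - x) ^ 2 = deriv (fun y => min (a y) (b y)) x ^ 2 := by
      have h1 : (fun y => G (τ - y)) =ᶠ[𝓝 x] fun y => min (a y) (b y) := by
        filter_upwards [gt_mem_nhds hx] with y hy using hGr y hy
      rw [← h1.deriv_eq, deriv_comp_const_sub, neg_sq]
    have hda : deriv a x = deriv g (x - τ) := deriv_comp_sub_const ..
    have hdb : deriv b x = -deriv g (-x) := deriv_comp_neg ..
    have hGx : G x = max (a x) (b x) := by simp [hGdef, polarization, hx, ha, hb]
    have hpot : V₁ x * G x ^ 2 + V₁ (τ - x) * G (τ - x) ^ 2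
        ≤ V₂ (x - τ) * a x ^ 2 + V₂ (-x) * b x ^ 2 := by
      rw [hGr x hx]
      have ha0 : 0 ≤ a x := hg0 _
      have hb0 : 0 ≤ b x := hg0 _
      by_cases hb1 : b x = 0
      · rw [hGx, hb1, max_eq_left ha0, min_eq_right ha0]
        by_cases ha1 : a x = 0
        · simp [ha1]
        · have hxa : x - τ ∈ Icc (-L) L := by
            by_contra h; exact ha1 (hg.2 _ h)
          have hxx : x ∈ Icc (-L) L := by
            by_contra h
            have := hG.2 x h
            rw [hGx, hb1, max_eq_left ha0] at this
            exact ha1 this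
          have := htrans (x - τ) hxa (by simpa using hxx)
          rw [sub_add_cancel] at this
          simp [this]
      · have hxb : -x ∈ Icc (-L) L := by
          by_contra h; exact hb1 (hg.2 _ h)
        have hxx : x ∈ Icc (-L) L := by simpa using neg_mem_Icc_neg_self hxb
        have h1 := hle x hxx hx.le
        by_cases ha1 : a x = 0
        · rw [hGx, ha1, max_eq_right hb0, min_eq_left hb0]
          have := mul_le_mul_of_nonneg_right h1 (sq_nonneg (b x))
          simpa using this
        · have hxa : x - τ ∈ Icc (-L) L := by
            by_contra h; exact ha1 (hg.2 _ h)
          have h2 := htrans (x - τ) hxa (by simpa using hxx)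
          have h3 := htrans (-x) hxb (by
            have := neg_mem_Icc_neg_self hxa
            rwa [neg_sub, sub_eq_neg_add] at this)
          rw [sub_add_cancel] at h2
          rw [neg_add_eq_sub] at h3
          rw [hGx, h3, ← h2]
          rcases le_total (a x) (b x) with h | h
          · rw [max_eq_right h, min_eq_left h]
            have : a x ^ 2 ≤ b x ^ 2 := pow_le_pow_left₀ ha0 h 2
            nlinarith
          · rw [max_eq_left h, min_eq_right h]
    simp only [he₁, he₂, hd1, hd2]
    rw [hda, hdb, neg_sq] at hd
    simp only [ha, hb] at hpot hd ⊢
    linarith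
  -- ... and by symmetry on its right.
  have hright : ∀ᵐ x, τ - x < τ / 2 → e₁ (τ - x) + e₁ x ≤ e₂ (-x) + e₂ (x - τ) := by
    have := (Measure.measurePreserving_sub_left (volume : Measure ℝ) τ).quasiMeasurePreserving.ae
      hleft
    filter_upwards [this] with x hx
    simpa using hx
  have hae : ∀ᵐ x, e₁ x + e₁ (τ - x) ≤ e₂ (x - τ) + e₂ (-x) := by
    have hne : ∀ᵐ x : ℝ, x ≠ τ / 2 := by simp [ae_iff]
    filter_upwards [hleft, hright, hne] with x h1 h2 h3
    rcases lt_or_gt_of_ne h3 with h | h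
    · exact h1 h
    · linarith [h2 (by linarith)]
  have hint := integral_mono_ae (hi₁.add (hi₁.comp_sub_left τ))
    ((hi₂.comp_sub_right τ).add hi₂.comp_neg) hae
  simp only [Pi.add_apply] at hint
  rw [integral_add hi₁ (hi₁.comp_sub_left τ), integral_add (hi₂.comp_sub_right τ) hi₂.comp_neg,
    integral_sub_left_eq_self, integral_sub_right_eq_self (μ := volume) e₂ τ,
    integral_neg_eq_self] at hint
  change ∫ x, e₁ x ≤ ∫ x, e₂ x
  linarith

/-- Nonnegativity of the Dirichlet form passes to a potential that is larger in the sense of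
`PolarizesBelow`. -/
lemma PolarizesBelow.schrodingerEnergy_nonneg (h : PolarizesBelow L V₁ V₂)
    (hV₁ : ContinuousOn V₁ (Icc (-L) L)) (hV₂ : ContinuousOn V₂ (Icc (-L) L))
    (hpos : ∀ g, IsDirichletTest L g → 0 ≤ schrodingerEnergy V₁ g) (hg : IsDirichletTest L g) :
    0 ≤ schrodingerEnergy V₂ g := by
  obtain ⟨τ, htrans, ⟨hτ, hle⟩ | ⟨hτ, hle⟩⟩ := h
  · rw [← schrodingerEnergy_abs hg]
    exact (hpos _ (hg.abs.polarization hτ fun _ => abs_nonneg _)).trans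
      (schrodingerEnergy_polarization_le hτ hg.abs (fun _ => abs_nonneg _) hV₁ hV₂ htrans hle)
  · -- A shift to the left becomes a shift to the right after reflection.
    have hmaps : MapsTo (fun x : ℝ => -x) (Icc (-L) L) (Icc (-L) L) :=
      fun x hx => neg_mem_Icc_neg_self hx
    have hg' := hg.comp_neg.abs
    have key := schrodingerEnergy_polarization_le (τ := -τ) (V₁ := fun x => V₁ (-x))
      (V₂ := fun x => V₂ (-x)) (by linarith) hg' (fun _ => abs_nonneg _)
      (hV₁.comp continuous_neg.continuousOn hmaps) (hV₂.comp continuous_neg.continuousOn hmaps)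
      (fun x hx hx' => by
        have := htrans (-x) (hmaps hx) (by
          have := hmaps hx'
          simpa [neg_add, add_comm] using this)
        simpa [neg_add, add_comm] using this)
      (fun x hx hx' => hle (-x) (hmaps hx) (by linarith))
    rw [schrodingerEnergy_abs hg.comp_neg, schrodingerEnergy_comp_neg] at key
    refine le_trans ?_ key
    have h1 := hpos _ (hg'.polarization (τ := -τ) (by linarith) fun _ => abs_nonneg _).comp_neg
    rw [← schrodingerEnergy_comp_neg] at h1
    simpa using h1

end

/-! ### The Poincaré constant of a density on an interval -/

/-- The measure `J · 1_{[-L, L]} · m`. -/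
def intervalDensity (L : ℝ) (J : ℝ → ℝ) : Measure ℝ :=
  (volume.restrict (Icc (-L) L)).withDensity fun x => ENNReal.ofReal (J x)

section
variable {L : ℝ} {J : ℝ → ℝ}

lemma setIntegral_Icc_eq_intervalIntegral (hL : 0 ≤ L) (f : ℝ → ℝ) :
    ∫ x in Icc (-L) L, f x = ∫ x in -L..L, f x := by
  rw [intervalIntegral.integral_of_le (by linarith), integral_Icc_eq_integral_Ioc]

lemma aemeasurable_ofReal_restrict (hJ : ContinuousOn J (Icc (-L) L)) :
    AEMeasurable (fun x => ENNReal.ofReal (J x)) (volume.restrict (Icc (-L) L)) :=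
  (hJ.aemeasurable measurableSet_Icc).ennreal_ofReal

lemma integral_intervalDensity (hL : 0 ≤ L) (hJ : ContinuousOn J (Icc (-L) L))
    (hJ0 : ∀ x ∈ Icc (-L) L, 0 < J x) (f : ℝ → ℝ) :
    ∫ x, f x ∂intervalDensity L J = ∫ x in -L..L, f x * J x := by
  rw [intervalDensity, integral_withDensity_eq_integral_toReal_smul₀
    (aemeasurable_ofReal_restrict hJ) (by simp), ← setIntegral_Icc_eq_intervalIntegral hL]
  refine setIntegral_congr_fun measurableSet_Icc fun x hx => ?_
  simp [ENNReal.toReal_ofReal (hJ0 x hx).le, mul_comm]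

lemma integrable_intervalDensity (hJ : ContinuousOn J (Icc (-L) L))
    (hJ0 : ∀ x ∈ Icc (-L) L, 0 < J x) {f : ℝ → ℝ} (hf : Continuous f) :
    Integrable f (intervalDensity L J) := by
  rw [intervalDensity, integrable_withDensity_iff_integrable_smul₀'
    (aemeasurable_ofReal_restrict hJ) (by simp)]
  refine IntegrableOn.congr_fun (f := fun x => J x * f x)
    (hJ.mul hf.continuousOn).integrableOn_Icc (fun x hx => ?_) measurableSet_Icc
  simp [ENNReal.toReal_ofReal (hJ0 x hx).le]

lemma lintegral_sq_intervalDensity (hL : 0 ≤ L) (hJ : ContinuousOn J (Icc (-L) L))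
    (hJ0 : ∀ x ∈ Icc (-L) L, 0 < J x) {f : ℝ → ℝ} (hf : Continuous f) :
    ∫⁻ x, ENNReal.ofReal (f x ^ 2) ∂intervalDensity L J
      = ENNReal.ofReal (∫ x in -L..L, f x ^ 2 * J x) := by
  rw [← integral_intervalDensity hL hJ hJ0 fun x => f x ^ 2]
  exact (ofReal_integral_eq_lintegral_ofReal
    (integrable_intervalDensity hJ hJ0 (hf.pow 2)) (ae_of_all _ fun x => sq_nonneg _)).symm

lemma intervalIntegral_sq_mul_nonneg (hL : 0 ≤ L) (hJ0 : ∀ x ∈ Icc (-L) L, 0 < J x) (f : ℝ → ℝ) :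
    0 ≤ ∫ x in -L..L, f x ^ 2 * J x :=
  intervalIntegral.integral_nonneg (by linarith) fun x hx =>
    mul_nonneg (sq_nonneg _) (hJ0 x hx).le

/-- The Poincaré inequality over `C_c^∞`, as an inequality between real integrals. Only the values
of a test function on the interval matter, so the compact support may be dropped. -/
lemma le_poincareConstant_iff (hL : 0 < L) (hJ : ContinuousOn J (Icc (-L) L))
    (hJ0 : ∀ x ∈ Icc (-L) L, 0 < J x) (r : NNReal) :
    (r : ℝ≥0∞) ≤ poincareConstant (intervalDensity L J) ↔
      ∀ f : ℝ → ℝ, ContDiff ℝ ∞ f → ∫ x in -L..L, f x * J x = 0 →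
        r * ∫ x in -L..L, f x ^ 2 * J x ≤ ∫ x in -L..L, deriv f x ^ 2 * J x := by
  have hquot : ∀ f : ℝ → ℝ, ContDiff ℝ ∞ f → ((r : ℝ≥0∞) ≤ rayleigh (intervalDensity L J) f ↔
      r * ∫ x in -L..L, f x ^ 2 * J x ≤ ∫ x in -L..L, deriv f x ^ 2 * J x) := fun f hf => by
    have hA := intervalIntegral_sq_mul_nonneg hL.le hJ0 f
    have hB := intervalIntegral_sq_mul_nonneg hL.le hJ0 (deriv f)
    rw [rayleigh, lintegral_sq_intervalDensity hL.le hJ hJ0 hf.continuous,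
      lintegral_sq_intervalDensity hL.le hJ hJ0 (hf.continuous_deriv (by simp))]
    split_ifs with h
    · rw [ENNReal.le_div_iff_mul_le (Or.inl h.ne') (Or.inl ENNReal.ofReal_ne_top),
        ← ENNReal.ofReal_coe_nnreal, ← ENNReal.ofReal_mul r.coe_nonneg,
        ENNReal.ofReal_le_ofReal_iff hB]
    · have hA0 : ∫ x in -L..L, f x ^ 2 * J x = 0 :=
        le_antisymm (by simpa using h) hA
      simp [hA0, hB]
  constructor
  · intro h f hf hmean
    -- Multiply by a cutoff that is equal to `1` near the interval.
    let χ : ContDiffBump (0 : ℝ) := ⟨L + 1, L + 2, by linarith, by linarith⟩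
    set F : ℝ → ℝ := fun x => χ x * f x with hF
    have hFsm : ContDiff ℝ ∞ F := χ.contDiff.mul hf
    have hFf : ∀ x ∈ Icc (-L) L, F =ᶠ[𝓝 x] f := fun x hx => by
      have : x ∈ Metric.ball (0 : ℝ) (L + 1) := by
        rw [Metric.mem_ball, Real.dist_0_eq_abs, abs_lt]
        exact ⟨by linarith [hx.1], by linarith [hx.2]⟩
      filter_upwards [χ.eventuallyEq_one_of_mem_ball this] with y hy
      simp [hF, hy]
    have hu : uIcc (-L) L = Icc (-L) L := uIcc_of_le (by linarith)
    have e0 : ∫ x in -L..L, F x * J x = ∫ x in -L..L, f x * J x :=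
      intervalIntegral.integral_congr fun x hx => by
        simp only [(hFf x (hu ▸ hx)).eq_of_nhds]
    have e1 : ∫ x in -L..L, F x ^ 2 * J x = ∫ x in -L..L, f x ^ 2 * J x :=
      intervalIntegral.integral_congr fun x hx => by
        simp only [(hFf x (hu ▸ hx)).eq_of_nhds]
    have e2 : ∫ x in -L..L, deriv F x ^ 2 * J x = ∫ x in -L..L, deriv f x ^ 2 * J x :=
      intervalIntegral.integral_congr fun x hx => by
        simp only [(hFf x (hu ▸ hx)).deriv_eq]
    by_cases hF0 : F = 0
    · have e3 : ∫ x in -L..L, f x ^ 2 * J x = 0 := by rw [← e1]; simp [hF0]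
      rw [e3, mul_zero]
      exact intervalIntegral_sq_mul_nonneg hL.le hJ0 _
    · rw [← e1, ← e2]
      refine (hquot F hFsm).1 (h.trans (iInf₂_le F ⟨hF0, hFsm, χ.hasCompactSupport.mul_right,
        integrable_intervalDensity hJ hJ0 hFsm.continuous, ?_⟩))
      rw [integral_intervalDensity hL.le hJ hJ0, e0, hmean]
  · intro h
    refine le_iInf₂ fun f hf => ?_
    rw [hquot f hf.2.1]
    refine h f hf.2.1 ?_
    rw [← integral_intervalDensity hL.le hJ hJ0]
    exact hf.2.2.2.2

end

/-! ### Duality between the Neumann and the Dirichlet problem -/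

/-- On `[-L, L]` the function `R` is positive with `R' = (H / 2) R`, and `H` is continuously
differentiable with derivative `H'`: so `R` is the square root of a density `J` with logarithmic
derivative `H`. -/
structure IsRootDensity (L : ℝ) (R H H' : ℝ → ℝ) : Prop where
  pos : ∀ x ∈ Icc (-L) L, 0 < R x
  hasDerivAt : ∀ x ∈ Icc (-L) L, HasDerivAt R (H x / 2 * R x) x
  hasDerivAt_slope : ∀ x ∈ Icc (-L) L, HasDerivAt H (H' x) x
  continuousOn_deriv : ContinuousOn H' (Icc (-L) L)

lemma exists_lipschitzOnWith_of_hasDerivAt {a b : ℝ} {f f' : ℝ → ℝ}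
    (hf : ∀ x ∈ Icc a b, HasDerivAt f (f' x) x) (hf' : ContinuousOn f' (Icc a b)) :
    ∃ C, LipschitzOnWith C f (Icc a b) := by
  obtain ⟨C, hC⟩ := isCompact_Icc.exists_bound_of_continuousOn hf'
  refine ⟨C.toNNReal, (convex_Icc a b).lipschitzOnWith_of_nnnorm_hasDerivWithin_le
    (fun x hx => (hf x hx).hasDerivWithinAt) fun x hx => ?_⟩
  rw [← norm_toNNReal]
  exact Real.toNNReal_mono (hC x hx)

lemma sq_intervalIntegral_mul_le {a b : ℝ} (hab : a ≤ b) {φ ψ : ℝ → ℝ}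
    (hφ : IntervalIntegrable (fun x => φ x ^ 2) volume a b)
    (hψ : IntervalIntegrable (fun x => ψ x ^ 2) volume a b)
    (hφψ : IntervalIntegrable (fun x => φ x * ψ x) volume a b) :
    (∫ x in a..b, φ x * ψ x) ^ 2 ≤ (∫ x in a..b, φ x ^ 2) * ∫ x in a..b, ψ x ^ 2 := by
  have h : ∀ t : ℝ, 0 ≤ (∫ x in a..b, ψ x ^ 2) * (t * t) + (2 * ∫ x in a..b, φ x * ψ x) * t
      + ∫ x in a..b, φ x ^ 2 := fun t => by
    have h1 : 0 ≤ ∫ x in a..b, (φ x + t * ψ x) ^ 2 :=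
      intervalIntegral.integral_nonneg hab fun x _ => sq_nonneg _
    have h2 : ∫ x in a..b, (φ x + t * ψ x) ^ 2 = ∫ x in a..b,
        ((t * t) * ψ x ^ 2 + (2 * t) * (φ x * ψ x) + φ x ^ 2) :=
      intervalIntegral.integral_congr fun x _ => by ring
    rw [h2, intervalIntegral.integral_add ((hψ.const_mul _).add (hφψ.const_mul _)) hφ,
      intervalIntegral.integral_add (hψ.const_mul _) (hφψ.const_mul _),
      intervalIntegral.integral_const_mul, intervalIntegral.integral_const_mul] at h1
    linarith
  have := discrim_le_zero h
  rw [discrim] at this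
  nlinarith

lemma IsDirichletTest.eq_zero_right {L : ℝ} {g : ℝ → ℝ} (hg : IsDirichletTest L g) : g L = 0 := by
  have h1 : closure (Ioi L) ⊆ {x | g x = 0} :=
    closure_minimal (fun x hx => hg.2 x fun h => absurd h.2 (not_le.2 hx))
      (isClosed_eq hg.continuous continuous_const)
  exact h1 (by rw [closure_Ioi]; exact self_mem_Ici)

lemma IsDirichletTest.eq_zero_left {L : ℝ} {g : ℝ → ℝ} (hg : IsDirichletTest L g) :
    g (-L) = 0 :=
  hg.comp_neg.eq_zero_right

lemma IsDirichletTest.absolutelyContinuousOnInterval {L : ℝ} {g : ℝ → ℝ}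
    (hg : IsDirichletTest L g) (a b : ℝ) : AbsolutelyContinuousOnInterval g a b :=
  hg.1.choose_spec.lipschitzOnWith.absolutelyContinuousOnInterval

lemma IsDirichletTest.ae_differentiableAt {L : ℝ} {g : ℝ → ℝ} (hg : IsDirichletTest L g) :
    ∀ᵐ x, DifferentiableAt ℝ g x :=
  hg.1.choose_spec.ae_differentiableAt_real

namespace IsRootDensity

variable {L : ℝ} {R H H' g : ℝ → ℝ}

lemma continuousOn (hR : IsRootDensity L R H H') : ContinuousOn R (Icc (-L) L) :=
  fun x hx => (hR.hasDerivAt x hx).continuousAt.continuousWithinAt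

lemma continuousOn_slope (hR : IsRootDensity L R H H') : ContinuousOn H (Icc (-L) L) :=
  fun x hx => (hR.hasDerivAt_slope x hx).continuousAt.continuousWithinAt

lemma absolutelyContinuousOnInterval (hL : 0 ≤ L) (hR : IsRootDensity L R H H') :
    AbsolutelyContinuousOnInterval R (-L) L := by
  obtain ⟨C, hC⟩ := exists_lipschitzOnWith_of_hasDerivAt hR.hasDerivAt
    ((hR.continuousOn_slope.div_const 2).mul hR.continuousOn)
  rw [← uIcc_of_le (by linarith : -L ≤ L)] at hC
  exact hC.absolutelyContinuousOnInterval

lemma absolutelyContinuousOnInterval_slope (hL : 0 ≤ L) (hR : IsRootDensity L R H H') :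
    AbsolutelyContinuousOnInterval H (-L) L := by
  obtain ⟨C, hC⟩ := exists_lipschitzOnWith_of_hasDerivAt hR.hasDerivAt_slope
    hR.continuousOn_deriv
  rw [← uIcc_of_le (by linarith : -L ≤ L)] at hC
  exact hC.absolutelyContinuousOnInterval

lemma intervalIntegrable_of_continuousOn (hL : 0 ≤ L) {f : ℝ → ℝ}
    (hf : ContinuousOn f (Icc (-L) L)) : IntervalIntegrable f volume (-L) L :=
  ContinuousOn.intervalIntegrable (by rwa [uIcc_of_le (by linarith : -L ≤ L)])

lemma intervalIntegrable_deriv_mul (hL : 0 ≤ L) (hg : IsDirichletTest L g) {f : ℝ → ℝ}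
    (hf : ContinuousOn f (Icc (-L) L)) :
    IntervalIntegrable (fun x => deriv g x * f x) volume (-L) L :=
  (hg.absolutelyContinuousOnInterval _ _).intervalIntegrable_deriv.mul_continuousOn
    (by rwa [uIcc_of_le (by linarith : -L ≤ L)])

lemma intervalIntegrable_conj_sq (hL : 0 ≤ L) (hR : IsRootDensity L R H H')
    (hg : IsDirichletTest L g) :
    IntervalIntegrable (fun x => (deriv g x + H x / 2 * g x) ^ 2) volume (-L) L := by
  have hgc := hg.continuous.continuousOn (s := Icc (-L) L)
  have h1 := hg.integrable_deriv_sq.intervalIntegrable (a := -L) (b := L)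
  have h2 := intervalIntegrable_deriv_mul hL hg (hR.continuousOn_slope.mul hgc)
  have h3 := intervalIntegrable_of_continuousOn hL
    (((hR.continuousOn_slope.div_const 2).mul hgc).pow 2)
  refine ((h1.add h2).add h3).congr fun x _ => ?_
  simp only [Pi.mul_apply, Pi.pow_apply]
  ring

/-- Conjugation by the root of the density turns the Dirichlet form of `1 / J` into that of a
Schrödinger operator. -/
lemma integral_conj_sq (hL : 0 ≤ L) (hR : IsRootDensity L R H H') (hg : IsDirichletTest L g) :
    ∫ x in -L..L, (deriv g x + H x / 2 * g x) ^ 2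
      = ∫ x in -L..L, (deriv g x ^ 2 + (H x ^ 2 / 4 - H' x / 2) * g x ^ 2) := by
  have hu : uIcc (-L) L = Icc (-L) L := uIcc_of_le (by linarith)
  have hgc := hg.continuous.continuousOn (s := Icc (-L) L)
  have hga := hg.absolutelyContinuousOnInterval (-L) L
  have hac := (hR.absolutelyContinuousOnInterval_slope hL).fun_mul (hga.fun_mul hga)
  have h0 := hac.integral_deriv_eq_sub
  rw [hg.eq_zero_left, hg.eq_zero_right] at h0
  have hV : ContinuousOn (fun x => H x ^ 2 / 4 - H' x / 2) (Icc (-L) L) :=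
    ((hR.continuousOn_slope.pow 2).div_const 4).sub (hR.continuousOn_deriv.div_const 2)
  rw [← sub_eq_zero, ← intervalIntegral.integral_sub (hR.intervalIntegrable_conj_sq hL hg)
    (hg.integrable_energy hV).intervalIntegrable]
  have h1 : ∫ x in -L..L, ((deriv g x + H x / 2 * g x) ^ 2
      - (deriv g x ^ 2 + (H x ^ 2 / 4 - H' x / 2) * g x ^ 2))
      = ∫ x in -L..L, 1 / 2 * deriv (fun y => H y * (g y * g y)) x := by
    refine intervalIntegral.integral_congr_ae ?_
    filter_upwards [hg.ae_differentiableAt] with x hx hxm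
    have hx' := hR.hasDerivAt_slope x (hu ▸ uIoc_subset_uIcc hxm)
    have h2 := (hx'.fun_mul (hx.hasDerivAt.fun_mul hx.hasDerivAt)).deriv
    rw [h2]
    ring
  rw [h1, intervalIntegral.integral_const_mul, h0]
  ring

lemma schrodingerEnergy_eq (hL : 0 ≤ L) (hR : IsRootDensity L R H H') (hg : IsDirichletTest L g)
    (r : ℝ) :
    schrodingerEnergy (fun x => H x ^ 2 / 4 - H' x / 2 - r) g
      = (∫ x in -L..L, (deriv g x + H x / 2 * g x) ^ 2) - r * ∫ x in -L..L, g x ^ 2 := by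
  have hV : ContinuousOn (fun x => H x ^ 2 / 4 - H' x / 2) (Icc (-L) L) :=
    ((hR.continuousOn_slope.pow 2).div_const 4).sub (hR.continuousOn_deriv.div_const 2)
  rw [hR.integral_conj_sq hL hg, ← intervalIntegral.integral_const_mul,
    ← intervalIntegral.integral_sub (hg.integrable_energy hV).intervalIntegrable
      ((continuous_const.fun_mul (hg.continuous.fun_pow 2)).intervalIntegrable _ _),
    ← setIntegral_Icc_eq_intervalIntegral hL,
    setIntegral_eq_integral_of_forall_compl_eq_zero fun x hx => by
      simp [hg.2 x hx, hg.deriv_eq_zero hx]]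
  refine integral_congr_ae (ae_of_all _ fun x => ?_)
  ring

/-- A smooth function `f` of mean zero, paired with `v = g R` for a Dirichlet test function `g`. -/
lemma sq_integral_mul_deriv_le (hL : 0 ≤ L) (hR : IsRootDensity L R H H')
    (hg : IsDirichletTest L g) {f : ℝ → ℝ} (hf : ContDiff ℝ ∞ f) :
    (∫ x in -L..L, g x * R x * deriv f x) ^ 2
      ≤ (∫ x in -L..L, (deriv g x + H x / 2 * g x) ^ 2) * ∫ x in -L..L, f x ^ 2 * R x ^ 2 := by
  have hu : uIcc (-L) L = Icc (-L) L := uIcc_of_le (by linarith)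
  have hga := hg.absolutelyContinuousOnInterval (-L) L
  have hfa : AbsolutelyContinuousOnInterval f (-L) L := by
    obtain ⟨C, hC⟩ := exists_lipschitzOnWith_of_hasDerivAt (a := -L) (b := L) (f := f)
      (f' := deriv f) (fun x _ => (hf.differentiable (by simp) x).hasDerivAt)
      (hf.continuous_deriv (by simp)).continuousOn
    exact (hu ▸ hC).absolutelyContinuousOnInterval
  have hfc := hf.continuous.continuousOn (s := Icc (-L) L)
  have h1 := (hga.fun_mul (hR.absolutelyContinuousOnInterval hL)).integral_mul_deriv_eq_deriv_mul
    hfa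
  rw [hg.eq_zero_left, hg.eq_zero_right] at h1
  have h2 : ∫ x in -L..L, deriv (fun y => g y * R y) x * f x
      = ∫ x in -L..L, (deriv g x + H x / 2 * g x) * (f x * R x) := by
    refine intervalIntegral.integral_congr_ae ?_
    filter_upwards [hg.ae_differentiableAt] with x hx hxm
    rw [(hx.hasDerivAt.fun_mul (hR.hasDerivAt x (hu ▸ uIoc_subset_uIcc hxm))).deriv]
    ring
  rw [h1, h2]
  simp only [zero_mul, sub_zero, zero_sub, neg_sq, ← mul_pow]
  refine sq_intervalIntegral_mul_le (by linarith) (hR.intervalIntegrable_conj_sq hL hg)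
    (intervalIntegrable_of_continuousOn hL ((hfc.mul hR.continuousOn).pow 2)) ?_
  refine ((intervalIntegrable_deriv_mul hL hg (hfc.mul hR.continuousOn)).add
    (intervalIntegrable_of_continuousOn hL (f := fun x => H x / 2 * g x * (f x * R x))
    (((hR.continuousOn_slope.div_const 2).mul hg.continuous.continuousOn).mul
      (hfc.mul hR.continuousOn)))).congr fun x _ => ?_
  simp only [Pi.mul_apply]
  ring

/-- The Poincaré inequality for `J = R ^ 2` implies the Dirichlet inequality. The function that
should be inserted into the former is an antiderivative of `v / J = g / R`; it is approximated by
antiderivatives of polynomials. -/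
lemma dirichlet_of_poincare (hL : 0 < L) (hR : IsRootDensity L R H H') {r : ℝ} (hr : 0 ≤ r)
    (hP : ∀ f : ℝ → ℝ, ContDiff ℝ ∞ f → ∫ x in -L..L, f x * R x ^ 2 = 0 →
      r * ∫ x in -L..L, f x ^ 2 * R x ^ 2 ≤ ∫ x in -L..L, deriv f x ^ 2 * R x ^ 2)
    (hg : IsDirichletTest L g) :
    r * ∫ x in -L..L, g x ^ 2 ≤ ∫ x in -L..L, (deriv g x + H x / 2 * g x) ^ 2 := by
  set E := ∫ x in -L..L, (deriv g x + H x / 2 * g x) ^ 2 with hE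
  have hE0 : 0 ≤ E := intervalIntegral.integral_nonneg (by linarith) fun x _ => sq_nonneg _
  have hu : uIcc (-L) L = Icc (-L) L := uIcc_of_le (by linarith)
  have hRc := hR.continuousOn
  have hgc := hg.continuous.continuousOn (s := Icc (-L) L)
  have hpoly : ∀ p : Polynomial ℝ, r * (∫ x in -L..L, g x * R x * p.eval x) ^ 2
      ≤ E * ∫ x in -L..L, (p.eval x) ^ 2 * R x ^ 2 := fun p => by
    set P : ℝ → ℝ := fun x => ∫ t in (0 : ℝ)..x, p.eval t with hPdef
    have hPd : ∀ x, HasDerivAt P (p.eval x) x := fun x =>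
      intervalIntegral.integral_hasDerivAt_right (p.continuous.intervalIntegrable _ _)
        (p.continuous.stronglyMeasurableAtFilter _ _) p.continuous.continuousAt
    set m := (∫ x in -L..L, P x * R x ^ 2) / ∫ x in -L..L, R x ^ 2 with hm
    set f : ℝ → ℝ := fun x => P x - m with hf
    have hfd : ∀ x, HasDerivAt f (p.eval x) x := fun x => (hPd x).sub_const m
    have hderiv : deriv f = fun x => p.eval x := funext fun x => (hfd x).deriv
    have hfs : ContDiff ℝ ∞ f := contDiff_infty_iff_deriv.2
      ⟨fun x => (hfd x).differentiableAt, by rw [hderiv]; simpa using p.contDiff_aeval (𝕜 := ℝ) ∞⟩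
    have hmass : 0 < ∫ x in -L..L, R x ^ 2 :=
      intervalIntegral.intervalIntegral_pos_of_pos_on
        (intervalIntegrable_of_continuousOn hL.le (hRc.pow 2))
        (fun x hx => pow_pos (hR.pos x (Ioo_subset_Icc_self hx)) 2) (by linarith)
    have hPc : Continuous P := continuous_iff_continuousAt.2 fun x => (hPd x).continuousAt
    have hmean : ∫ x in -L..L, f x * R x ^ 2 = 0 := by
      simp only [hf, sub_mul]
      rw [intervalIntegral.integral_sub
        (intervalIntegrable_of_continuousOn hL.le (hPc.continuousOn.fun_mul (hRc.fun_pow 2)))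
        (intervalIntegrable_of_continuousOn hL.le (continuousOn_const.fun_mul (hRc.fun_pow 2))),
        intervalIntegral.integral_const_mul, hm, div_mul_cancel₀ _ hmass.ne', sub_self]
    have h1 := hR.sq_integral_mul_deriv_le hL.le hg hfs
    have h2 := hP f hfs hmean
    rw [hderiv] at h1 h2
    calc r * (∫ x in -L..L, g x * R x * p.eval x) ^ 2
        ≤ r * (E * ∫ x in -L..L, f x ^ 2 * R x ^ 2) := mul_le_mul_of_nonneg_left h1 hr
      _ = E * (r * ∫ x in -L..L, f x ^ 2 * R x ^ 2) := by ring
      _ ≤ _ := mul_le_mul_of_nonneg_left h2 hE0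
  have hφ : ContinuousOn (fun x => g x / R x) (Icc (-L) L) :=
    hgc.div hRc fun x hx => (hR.pos x hx).ne'
  choose p hp using fun n : ℕ =>
    exists_polynomial_near_of_continuousOn (-L) L _ hφ (1 / ((n : ℝ) + 1)) (by positivity)
  obtain ⟨B, hB⟩ := isCompact_Icc.exists_bound_of_continuousOn hφ
  have hlim : ∀ x ∈ Icc (-L) L, Tendsto (fun n => (p n).eval x) atTop (𝓝 (g x / R x)) :=
    fun x hx => by
      refine tendsto_iff_dist_tendsto_zero.2 (squeeze_zero (fun _ => dist_nonneg)
        (fun n => ?_) tendsto_one_div_add_atTop_nhds_zero_nat)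
      rw [Real.dist_eq]
      exact (hp n x hx).le
  have hbd : ∀ n, ∀ x ∈ Icc (-L) L, |(p n).eval x| ≤ B + 1 := fun n x hx => by
    have h1 := hp n x hx
    have h2 := hB x hx
    rw [Real.norm_eq_abs] at h2
    have h3 : 1 / ((n : ℝ) + 1) ≤ 1 := by
      rw [div_le_one (by positivity)]
      linarith [n.cast_nonneg (α := ℝ)]
    have h4 : |(p n).eval x| ≤ |(p n).eval x - g x / R x| + |g x / R x| := by
      simpa using abs_add_le ((p n).eval x - g x / R x) (g x / R x)
    linarith
  have hsub : ∀ x, x ∈ uIoc (-L) L → x ∈ Icc (-L) L := fun x hx => hu ▸ uIoc_subset_uIcc hx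
  have hlim1 : Tendsto (fun n => ∫ x in -L..L, g x * R x * (p n).eval x) atTop
      (𝓝 (∫ x in -L..L, g x ^ 2)) := by
    have heq : ∫ x in -L..L, g x ^ 2 = ∫ x in -L..L, g x * R x * (g x / R x) :=
      intervalIntegral.integral_congr fun x hx => by
        have := (hR.pos x (hu ▸ hx)).ne'
        field_simp
    rw [heq]
    refine intervalIntegral.tendsto_integral_filter_of_dominated_convergence
      (fun x => |g x * R x| * (B + 1)) (Eventually.of_forall fun n => ?_)
      (Eventually.of_forall fun n => ae_of_all _ fun x hx => ?_)
      (intervalIntegrable_of_continuousOn hL.le ((hgc.mul hRc).abs.mul continuousOn_const))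
      (ae_of_all _ fun x hx => (hlim x (hsub x hx)).const_mul _)
    · exact (intervalIntegrable_of_continuousOn hL.le
        ((hgc.mul hRc).mul (p n).continuous.continuousOn)).def'.aestronglyMeasurable
    · rw [norm_mul, Real.norm_eq_abs, Real.norm_eq_abs]
      exact mul_le_mul_of_nonneg_left (hbd n x (hsub x hx)) (abs_nonneg _)
  have hlim2 : Tendsto (fun n => ∫ x in -L..L, (p n).eval x ^ 2 * R x ^ 2) atTop
      (𝓝 (∫ x in -L..L, g x ^ 2)) := by
    have heq : ∫ x in -L..L, g x ^ 2 = ∫ x in -L..L, (g x / R x) ^ 2 * R x ^ 2 :=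
      intervalIntegral.integral_congr fun x hx => by
        have := (hR.pos x (hu ▸ hx)).ne'
        field_simp
    rw [heq]
    refine intervalIntegral.tendsto_integral_filter_of_dominated_convergence
      (fun x => (B + 1) ^ 2 * R x ^ 2) (Eventually.of_forall fun n => ?_)
      (Eventually.of_forall fun n => ae_of_all _ fun x hx => ?_)
      (intervalIntegrable_of_continuousOn hL.le (continuousOn_const.mul (hRc.pow 2)))
      (ae_of_all _ fun x hx => ((hlim x (hsub x hx)).pow 2).mul_const _)
    · exact (intervalIntegrable_of_continuousOn hL.le
        (((p n).continuous.continuousOn.pow 2).mul (hRc.pow 2))).def'.aestronglyMeasurable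
    · rw [norm_mul, norm_pow, norm_pow, Real.norm_eq_abs, Real.norm_eq_abs, sq_abs (R x)]
      exact mul_le_mul_of_nonneg_right
        (pow_le_pow_left₀ (abs_nonneg _) (hbd n x (hsub x hx)) 2) (sq_nonneg _)
  have hfin : r * (∫ x in -L..L, g x ^ 2) ^ 2 ≤ E * ∫ x in -L..L, g x ^ 2 :=
    le_of_tendsto_of_tendsto' ((hlim1.pow 2).const_mul r) (hlim2.const_mul E) fun n => hpoly (p n)
  have hA : 0 ≤ ∫ x in -L..L, g x ^ 2 :=
    intervalIntegral.integral_nonneg (by linarith) fun x _ => sq_nonneg _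
  rcases hA.eq_or_lt with hA | hA
  · rw [← hA, mul_zero]; exact hE0
  · refine le_of_mul_le_mul_right ?_ hA
    linarith

/-- The Dirichlet inequality implies the Poincaré inequality: insert `g = v / R`, where `v` is the
antiderivative of `f J` that vanishes at both end points. -/
lemma poincare_of_dirichlet (hL : 0 < L) (hR : IsRootDensity L R H H') {r : ℝ} (hr : 0 ≤ r)
    (hD : ∀ g, IsDirichletTest L g →
      r * ∫ x in -L..L, g x ^ 2 ≤ ∫ x in -L..L, (deriv g x + H x / 2 * g x) ^ 2)
    {f : ℝ → ℝ} (hf : ContDiff ℝ ∞ f) (hmean : ∫ x in -L..L, f x * R x ^ 2 = 0) :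
    r * ∫ x in -L..L, f x ^ 2 * R x ^ 2 ≤ ∫ x in -L..L, deriv f x ^ 2 * R x ^ 2 := by
  have hLL : -L ≤ L := by linarith
  have hu : uIcc (-L) L = Icc (-L) L := uIcc_of_le hLL
  have hRc := hR.continuousOn
  have hfc := hf.continuous.continuousOn (s := Icc (-L) L)
  have hf'c := (hf.continuous_deriv (by simp)).continuousOn (s := Icc (-L) L)
  -- A continuous extension of `f J` to the line.
  set q : ℝ → ℝ := IccExtend hLL ((Icc (-L) L).domRestrict fun x => f x * R x ^ 2) with hq
  have hqc : Continuous q :=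
    (continuousOn_iff_continuous_domRestrict.1 (hfc.mul (hRc.pow 2))).Icc_extend'
  have hqx : ∀ x ∈ Icc (-L) L, q x = f x * R x ^ 2 := fun x hx => IccExtend_of_mem hLL _ hx
  set v : ℝ → ℝ := fun x => ∫ t in -L..x, q t with hv
  have hvd : ∀ x, HasDerivAt v (q x) x := fun x =>
    intervalIntegral.integral_hasDerivAt_right (hqc.intervalIntegrable _ _)
      (hqc.stronglyMeasurableAtFilter _ _) hqc.continuousAt
  have hvl : v (-L) = 0 := intervalIntegral.integral_same
  have hvr : v L = 0 := by
    rw [← hmean]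
    exact intervalIntegral.integral_congr fun x hx => hqx x (hu ▸ hx)
  set g₀ : ℝ → ℝ := fun x => v x / R x with hg₀
  have hg₀d : ∀ x ∈ Icc (-L) L, HasDerivAt g₀ (f x * R x - H x / 2 * g₀ x) x := fun x hx => by
    have hne := (hR.pos x hx).ne'
    convert! (hvd x).div (hR.hasDerivAt x hx) hne using 1
    rw [hqx x hx]
    simp only [hg₀]
    field_simp
  have hg₀c : ContinuousOn g₀ (Icc (-L) L) := fun x hx =>
    (hg₀d x hx).continuousAt.continuousWithinAt
  obtain ⟨C, hC⟩ := exists_lipschitzOnWith_of_hasDerivAt hg₀d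
    ((hfc.mul hRc).sub ((hR.continuousOn_slope.div_const 2).mul hg₀c))
  set g : ℝ → ℝ := IccExtend hLL ((Icc (-L) L).domRestrict g₀) with hgdef
  have hgx : ∀ x ∈ Icc (-L) L, g x = g₀ x := fun x hx => IccExtend_of_mem hLL _ hx
  have hg : IsDirichletTest L g := by
    refine ⟨⟨C * 1, (lipschitzOnWith_iff_restrict.1 hC).comp (LipschitzWith.projIcc hLL)⟩,
      fun x hx => ?_⟩
    rcases not_and_or.1 hx with h | h
    · rw [hgdef, IccExtend_of_le_left hLL _ (not_le.1 h).le]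
      change v (-L) / R (-L) = 0
      rw [hvl, zero_div]
    · rw [hgdef, IccExtend_of_right_le hLL _ (not_le.1 h).le]
      change v L / R L = 0
      rw [hvr, zero_div]
  have hgd : ∀ x ∈ Ioo (-L) L, deriv g x = f x * R x - H x / 2 * g₀ x := fun x hx => by
    have h1 : g =ᶠ[𝓝 x] g₀ := by
      filter_upwards [isOpen_Ioo.mem_nhds hx] with y hy using hgx y (Ioo_subset_Icc_self hy)
    rw [h1.deriv_eq, (hg₀d x (Ioo_subset_Icc_self hx)).deriv]
  have h1 := hD g hg
  have h2 : ∫ x in -L..L, (deriv g x + H x / 2 * g x) ^ 2 = ∫ x in -L..L, f x ^ 2 * R x ^ 2 :=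
    intervalIntegral.integral_congr_Ioo_of_le hLL fun x hx => by
      simp only [hgd x hx, hgx x (Ioo_subset_Icc_self hx)]
      ring
  have h3 : ∫ x in -L..L, f x ^ 2 * R x ^ 2 = -∫ x in -L..L, (deriv f x * R x) * g x := by
    have h4 := intervalIntegral.integral_mul_deriv_eq_deriv_mul (a := -L) (b := L)
      (u := f) (v := v) (u' := deriv f) (v' := q)
      (fun x _ => (hf.differentiable (by simp) x).hasDerivAt) (fun x _ => hvd x)
      ((hf.continuous_deriv (by simp)).intervalIntegrable _ _) (hqc.intervalIntegrable _ _)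
    rw [hvl, hvr] at h4
    have h5 : ∫ x in -L..L, f x * q x = ∫ x in -L..L, f x ^ 2 * R x ^ 2 :=
      intervalIntegral.integral_congr fun x hx => by
        simp only [hqx x (hu ▸ hx)]
        ring
    have h6 : ∫ x in -L..L, deriv f x * v x = ∫ x in -L..L, (deriv f x * R x) * g x :=
      intervalIntegral.integral_congr fun x hx => by
        have := (hR.pos x (hu ▸ hx)).ne'
        simp only [hgx x (hu ▸ hx), hg₀]
        field_simp
    rw [← h5, h4, h6]
    ring
  have hgc := hg.continuous.continuousOn (s := Icc (-L) L)
  have h7 := sq_intervalIntegral_mul_le hLL (φ := fun x => deriv f x * R x) (ψ := g)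
    (intervalIntegrable_of_continuousOn hL.le ((hf'c.mul hRc).pow 2))
    (intervalIntegrable_of_continuousOn hL.le (hgc.pow 2))
    (intervalIntegrable_of_continuousOn hL.le ((hf'c.mul hRc).mul hgc))
  rw [h2] at h1
  rw [← neg_sq, ← h3] at h7
  simp only [mul_pow] at h7
  have hA : 0 ≤ ∫ x in -L..L, f x ^ 2 * R x ^ 2 :=
    intervalIntegral.integral_nonneg hLL fun x _ => by positivity
  have hB : 0 ≤ ∫ x in -L..L, deriv f x ^ 2 * R x ^ 2 :=
    intervalIntegral.integral_nonneg hLL fun x _ => by positivity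
  rcases hA.eq_or_lt with hA | hA
  · rw [← hA, mul_zero]; exact hB
  · refine le_of_mul_le_mul_right ?_ hA
    nlinarith [mul_le_mul_of_nonneg_left h7 hr, mul_le_mul_of_nonneg_left h1 hB]

/-- The Neumann spectral gap of `J = R ^ 2` is the lowest Dirichlet eigenvalue of the Schrödinger
operator with potential `H² / 4 - H' / 2`. -/
lemma le_poincareConstant_iff_schrodinger (hL : 0 < L) (hR : IsRootDensity L R H H')
    (r : NNReal) :
    (r : ℝ≥0∞) ≤ poincareConstant (intervalDensity L fun x => R x ^ 2) ↔
      ∀ g, IsDirichletTest L g →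
        0 ≤ schrodingerEnergy (fun x => H x ^ 2 / 4 - H' x / 2 - r) g := by
  rw [le_poincareConstant_iff (J := fun x => R x ^ 2) hL (hR.continuousOn.pow 2)
    fun x hx => pow_pos (hR.pos x hx) 2]
  constructor
  · intro h g hg
    rw [hR.schrodingerEnergy_eq hL.le hg, sub_nonneg]
    exact hR.dirichlet_of_poincare hL r.coe_nonneg h hg
  · intro h f hf hmean
    refine hR.poincare_of_dirichlet hL r.coe_nonneg (fun g hg => ?_) hf hmean
    have := h g hg
    rwa [hR.schrodingerEnergy_eq hL.le hg, sub_nonneg] at this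

end IsRootDensity

/-! ### The model density on a regular interval -/

/-- The number `1 / (N - 1)`, understood as `0` when `N = ∞`. -/
def dimInv : WithTop ℝ → ℝ
  | ⊤ => 0
  | (N : ℝ) => (N - 1)⁻¹

/-- The square root of the model density, where `modelBase` is positive. -/
def modelRoot (K : ℝ) (N : WithTop ℝ) (h x : ℝ) : ℝ :=
  match N with
  | ⊤ => Real.exp ((h * x - K / 2 * x ^ 2) / 2)
  | (N : ℝ) => modelBase K (N - 1)⁻¹ h x ^ ((N - 1) / 2)

lemma modelBase_zero_left (K h x : ℝ) : modelBase K 0 h x = 1 := by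
  simp [modelBase, cosDelta]

lemma modelSlope_zero_left (K h x : ℝ) : modelSlope K 0 h x = h - K * x := by
  simp [modelSlope, cosDelta, sinDelta]

lemma modelDensity_coe (K : ℝ) {N : ℝ} (hN : N ≠ 1) (h x : ℝ) :
    modelDensity K (N : WithTop ℝ) h x
      = ENNReal.ofReal (zeroCut (modelBase K (N - 1)⁻¹ h) x) ^ (N - 1) := by
  have h1 : modelDelta K (N : WithTop ℝ) = (N - 1)⁻¹ * K := by
    change (if N = 1 then 0 else K / (N - 1)) = _
    rw [if_neg hN, div_eq_inv_mul]
  have h2 : modelBase K (N - 1)⁻¹ h = fun y => cosDelta (modelDelta K (N : WithTop ℝ)) y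
      + h / (N - 1) * sinDelta (modelDelta K (N : WithTop ℝ)) y := by
    funext y
    rw [h1, modelBase, div_eq_inv_mul]
  rw [h2]
  change (if N = 1 then 1 else _) = _
  rw [if_neg hN]

lemma zeroCut_of_pos {f : ℝ → ℝ} {L : ℝ} (hL : 0 < L) (hf : ∀ x ∈ Icc (-L) L, 0 < f x) {x : ℝ}
    (hx : x ∈ Icc (-L) L) : zeroCut f x = f x := by
  have hmem : leftZero f ≤ (x : EReal) ∧ (x : EReal) ≤ rightZero f → zeroCut f x = f x :=
    fun h => indicator_of_mem (s := {x : ℝ | leftZero f ≤ (x : EReal) ∧ (x : EReal) ≤ rightZero f})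
      h f
  refine hmem ⟨sSup_le ?_, le_sInf ?_⟩
  · rintro _ ⟨y, ⟨hy0, hy⟩, rfl⟩
    refine EReal.coe_le_coe_iff.2 (le_of_not_ge fun hxy => ?_)
    exact (hf y ⟨hx.1.trans hxy, hy0.trans hL.le⟩).ne' hy
  · rintro _ ⟨y, ⟨hy0, hy⟩, rfl⟩
    refine EReal.coe_le_coe_iff.2 (le_of_not_ge fun hxy => ?_)
    exact (hf y ⟨by linarith, hxy.trans hx.2⟩).ne' hy

lemma zeroCut_eq_zero_of_right {f : ℝ → ℝ} {y z : ℝ} (hz0 : 0 < z) (hz : f z = 0) (hy : z < y) :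
    zeroCut f y = 0 := by
  refine indicator_of_notMem (fun h => ?_) f
  have h1 : rightZero f ≤ (z : EReal) := sInf_le ⟨z, ⟨hz0, hz⟩, rfl⟩
  exact absurd (EReal.coe_le_coe_iff.1 (h.2.trans h1)) (not_le.2 hy)

lemma zeroCut_eq_zero_of_left {f : ℝ → ℝ} {y z : ℝ} (hz0 : z ≤ 0) (hz : f z = 0) (hy : y < z) :
    zeroCut f y = 0 := by
  refine indicator_of_notMem (fun h => ?_) f
  have h1 : (z : EReal) ≤ leftZero f := le_sSup ⟨z, ⟨hz0, hz⟩, rfl⟩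
  exact absurd (EReal.coe_le_coe_iff.1 (h1.trans h.1)) (not_le.2 hy)

/-- An open set on which `J` is everywhere `0` or everywhere `∞` misses the double support. -/
lemma notMem_doubleSupport {J : ℝ → ℝ≥0∞} {U : Set ℝ} (hU : IsOpen U)
    (h : (∀ y ∈ U, J y = 0) ∨ ∀ y ∈ U, J y = ⊤) {y : ℝ} (hy : y ∈ U) : y ∉ doubleSupport J := by
  have key : ∀ J' : ℝ → ℝ≥0∞, (∀ y ∈ U, J' y = 0) → y ∉ (volume.withDensity J').support :=
    fun J' h0 => by
      refine Measure.subset_compl_support_of_isOpen hU ?_ hy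
      rw [withDensity_apply _ hU.measurableSet, setLIntegral_congr_fun hU.measurableSet h0]
      simp
  rcases h with h | h
  · exact fun hmem => key J h hmem.1
  · exact fun hmem => key (fun x => (J x)⁻¹) (fun y hy => by simp [h y hy]) hmem.2

/-- On a regular interval the base of the model density is positive: beyond a zero, the density
would be constantly `0` or `∞`. -/
lemma modelBase_pos_of_mem_regularDomain {K : ℝ} {N : WithTop ℝ} (hN : N ≠ ((1 : ℝ) : WithTop ℝ))
    {D h d : ℝ} (hreg : (h, d) ∈ regularDomain K N D) :
    ∀ x ∈ Icc (-(d / 2)) (d / 2), 0 < modelBase K (dimInv N) h x := by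
  obtain ⟨hd, -, hsub⟩ := hreg
  simp only at hd hsub
  induction N using WithTop.recTopCoe with
  | top =>
    intro x _
    change 0 < modelBase K 0 h x
    rw [modelBase_zero_left]
    exact one_pos
  | coe N =>
    change ∀ x ∈ Icc (-(d / 2)) (d / 2), 0 < modelBase K (N - 1)⁻¹ h x
    have hN1 : N ≠ 1 := fun h => hN (by rw [h])
    set w := modelBase K (N - 1)⁻¹ h with hw
    have hw0 : w 0 = 1 := modelBase_zero_right _ _ _
    have hwc : Continuous w := continuous_modelBase _ _ _
    have hzero : ∀ U : Set ℝ, (∀ y ∈ U, zeroCut w y = 0) →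
        (∀ y ∈ U, modelDensity K (N : WithTop ℝ) h y = 0) ∨
          ∀ y ∈ U, modelDensity K (N : WithTop ℝ) h y = ⊤ := fun U hU => by
      rcases lt_or_gt_of_ne hN1 with hlt | hgt
      · exact Or.inr fun y hy => by
          rw [modelDensity_coe K hN1, hU y hy, ENNReal.ofReal_zero,
            ENNReal.zero_rpow_of_neg (by linarith)]
      · exact Or.inl fun y hy => by
          rw [modelDensity_coe K hN1, hU y hy, ENNReal.ofReal_zero,
            ENNReal.zero_rpow_of_pos (by linarith)]
    intro x hx
    by_contra hneg
    have hwx : w x ≤ 0 := not_lt.1 hneg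
    obtain ⟨z, hz, hwz⟩ : ∃ z ∈ uIcc 0 x, w z = 0 :=
      intermediate_value_uIcc hwc.continuousOn (by
        rw [hw0, mem_uIcc]; exact Or.inr ⟨hwx, zero_le_one⟩)
    have hzI : z ∈ Icc (-(d / 2)) (d / 2) :=
      uIcc_subset_Icc ⟨by linarith, by linarith⟩ hx hz
    rcases lt_trichotomy z 0 with hz0 | hz0 | hz0
    · have hmem := hsub (left_mem_Icc.2 (by linarith : -(d / 2) ≤ d / 2))
      rw [mem_interior_iff_mem_nhds, Metric.mem_nhds_iff] at hmem
      obtain ⟨ε, hε, hball⟩ := hmem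
      have h1 : -(d / 2) - ε / 2 ∈ doubleSupport (modelDensity K (N : WithTop ℝ) h) :=
        hball (by
          rw [Metric.mem_ball, Real.dist_eq, abs_lt]
          exact ⟨by linarith, by linarith⟩)
      exact notMem_doubleSupport isOpen_Iio
        (hzero (Iio z) fun y hy => zeroCut_eq_zero_of_left hz0.le hwz hy)
        (by have := hzI.1; simp only [mem_Iio]; linarith) h1
    · rw [hz0, hw0] at hwz
      exact one_ne_zero hwz
    · have hmem := hsub (right_mem_Icc.2 (by linarith : -(d / 2) ≤ d / 2))
      rw [mem_interior_iff_mem_nhds, Metric.mem_nhds_iff] at hmem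
      obtain ⟨ε, hε, hball⟩ := hmem
      have h1 : d / 2 + ε / 2 ∈ doubleSupport (modelDensity K (N : WithTop ℝ) h) :=
        hball (by
          rw [Metric.mem_ball, Real.dist_eq, abs_lt]
          exact ⟨by linarith, by linarith⟩)
      exact notMem_doubleSupport isOpen_Ioi
        (hzero (Ioi z) fun y hy => zeroCut_eq_zero_of_right hz0 hwz hy)
        (by have := hzI.2; simp only [mem_Ioi]; linarith) h1

section
variable {K : ℝ} {N : WithTop ℝ} {h L : ℝ}

lemma modelDensity_eq_ofReal_modelRoot_sq (hN : N ≠ ((1 : ℝ) : WithTop ℝ)) (hL : 0 < L)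
    (hw : ∀ x ∈ Icc (-L) L, 0 < modelBase K (dimInv N) h x) {x : ℝ} (hx : x ∈ Icc (-L) L) :
    modelDensity K N h x = ENNReal.ofReal (modelRoot K N h x ^ 2) := by
  induction N using WithTop.recTopCoe with
  | top =>
    change ENNReal.ofReal (Real.exp _) = ENNReal.ofReal (Real.exp _ ^ 2)
    rw [← Real.exp_nat_mul]
    congr 2
    push_cast
    ring
  | coe N =>
    change ∀ x ∈ Icc (-L) L, 0 < modelBase K (N - 1)⁻¹ h x at hw
    have hN1 : N ≠ 1 := fun h => hN (by rw [h])
    rw [modelDensity_coe K hN1, zeroCut_of_pos hL hw hx, ENNReal.ofReal_rpow_of_pos (hw x hx)]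
    congr 1
    change _ = (modelBase K (N - 1)⁻¹ h x ^ ((N - 1) / 2)) ^ 2
    rw [← Real.rpow_natCast, ← Real.rpow_mul (hw x hx).le]
    norm_num

lemma isRootDensity_modelRoot (hN : N ≠ ((1 : ℝ) : WithTop ℝ))
    (hw : ∀ x ∈ Icc (-L) L, 0 < modelBase K (dimInv N) h x) :
    IsRootDensity L (modelRoot K N h) (logSlope K (dimInv N) h)
      (fun x => -(K + dimInv N * logSlope K (dimInv N) h x ^ 2)) := by
  have hH : ∀ x ∈ Icc (-L) L, HasDerivAt (logSlope K (dimInv N) h)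
      (-(K + dimInv N * logSlope K (dimInv N) h x ^ 2)) x :=
    fun x hx => hasDerivAt_logSlope K (dimInv N) h (hw x hx).ne'
  have hHc : ContinuousOn (logSlope K (dimInv N) h) (Icc (-L) L) :=
    fun x hx => (hH x hx).continuousAt.continuousWithinAt
  refine ⟨fun x hx => ?_, fun x hx => ?_, hH,
    (continuousOn_const.add (continuousOn_const.mul (hHc.pow 2))).neg⟩
  · induction N using WithTop.recTopCoe with
    | top => exact Real.exp_pos _
    | coe N => exact Real.rpow_pos_of_pos (hw x hx) _
  · induction N using WithTop.recTopCoe with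
    | top =>
      change HasDerivAt (fun x => Real.exp ((h * x - K / 2 * x ^ 2) / 2))
        (modelSlope K 0 h x / modelBase K 0 h x / 2 * Real.exp _) x
      rw [modelBase_zero_left, modelSlope_zero_left]
      convert! (((((hasDerivAt_id x).const_mul h).sub
        (((hasDerivAt_id x).pow 2).const_mul (K / 2))).div_const 2).exp) using 1
      simp
      ring
    | coe N =>
      have hN1 : N - 1 ≠ 0 := fun h => hN (by rw [sub_eq_zero.1 h])
      have hwx : 0 < modelBase K (N - 1)⁻¹ h x := hw x hx
      change HasDerivAt (fun x => modelBase K (N - 1)⁻¹ h x ^ ((N - 1) / 2))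
        (modelSlope K (N - 1)⁻¹ h x / modelBase K (N - 1)⁻¹ h x / 2
          * modelBase K (N - 1)⁻¹ h x ^ ((N - 1) / 2)) x
      convert! (hasDerivAt_modelBase K (N - 1)⁻¹ h x).rpow_const (p := (N - 1) / 2)
        (Or.inl hwx.ne') using 1
      rw [Real.rpow_sub_one hwx.ne']
      field_simp

lemma modelMeasure_eq_intervalDensity (hN : N ≠ ((1 : ℝ) : WithTop ℝ)) {d : ℝ} (hd : 0 < d)
    (hw : ∀ x ∈ Icc (-(d / 2)) (d / 2), 0 < modelBase K (dimInv N) h x) :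
    modelMeasure K N h d = intervalDensity (d / 2) fun x => modelRoot K N h x ^ 2 := by
  rw [modelMeasure, withDensity_indicator measurableSet_Icc, intervalDensity]
  refine withDensity_congr_ae ?_
  filter_upwards [ae_restrict_mem measurableSet_Icc] with x hx
  exact modelDensity_eq_ofReal_modelRoot_sq hN (by linarith) hw hx

end

/-- The potential of the Schrödinger operator of the model density, less the spectral
parameter. -/
def modelPotential (K κ r h x : ℝ) : ℝ :=
  (K / 2 - r) + (1 / 4 + κ / 2) * logSlope K κ h x ^ 2

lemma le_spectralGap_iff {K : ℝ} {N : WithTop ℝ} (hN : N ≠ ((1 : ℝ) : WithTop ℝ)) {D h d : ℝ}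
    (hreg : (h, d) ∈ regularDomain K N D) (r : NNReal) :
    (r : ℝ≥0∞) ≤ spectralGap K N h d ↔ ∀ g, IsDirichletTest (d / 2) g →
      0 ≤ schrodingerEnergy (modelPotential K (dimInv N) r h) g := by
  have hw := modelBase_pos_of_mem_regularDomain hN hreg
  have hd : 0 < d := hreg.1
  rw [spectralGap, modelMeasure_eq_intervalDensity hN hd hw,
    (isRootDensity_modelRoot hN hw).le_poincareConstant_iff_schrodinger (by linarith)]
  have : (fun x => logSlope K (dimInv N) h x ^ 2 / 4
      - -(K + dimInv N * logSlope K (dimInv N) h x ^ 2) / 2 - r)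
      = modelPotential K (dimInv N) r h := by
    funext x
    rw [modelPotential]
    ring
  rw [this]

lemma continuousOn_modelPotential {K κ h L : ℝ} (hw : ∀ x ∈ Icc (-L) L, 0 < modelBase K κ h x)
    (r : ℝ) : ContinuousOn (modelPotential K κ r h) (Icc (-L) L) :=
  continuousOn_const.add (continuousOn_const.mul (ContinuousOn.pow (fun x hx =>
    (hasDerivAt_logSlope K κ h (hw x hx).ne').continuousAt.continuousWithinAt) 2))

/-! ### Monotonicity of the spectral gap -/

section
variable {K : ℝ} {N : WithTop ℝ} {D : ℝ}

lemma spectralGap_le_of_forall {h₁ h₂ d₁ d₂ : ℝ}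
    (H : ∀ r : NNReal, (r : ℝ≥0∞) ≤ spectralGap K N h₁ d₁ → (r : ℝ≥0∞) ≤ spectralGap K N h₂ d₂) :
    spectralGap K N h₁ d₁ ≤ spectralGap K N h₂ d₂ :=
  ENNReal.le_of_forall_nnreal_lt fun r hr => H r hr.le

/-- Dirichlet test functions of a shorter interval extend by zero. -/
lemma spectralGap_anti_length (hN : N ≠ ((1 : ℝ) : WithTop ℝ)) {h d₁ d₂ : ℝ}
    (h₁ : (h, d₁) ∈ regularDomain K N D) (h₂ : (h, d₂) ∈ regularDomain K N D) (hd : d₁ ≤ d₂) :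
    spectralGap K N h d₂ ≤ spectralGap K N h d₁ := by
  refine spectralGap_le_of_forall fun r hr => ?_
  rw [le_spectralGap_iff hN h₂] at hr
  rw [le_spectralGap_iff hN h₁]
  exact fun g hg => hr g (hg.mono (by linarith))

/-- Reflection of the line exchanges `h` and `-h`. -/
lemma schrodingerEnergy_nonneg_neg {K κ r h L : ℝ}
    (H : ∀ g, IsDirichletTest L g → 0 ≤ schrodingerEnergy (modelPotential K κ r h) g) :
    ∀ g, IsDirichletTest L g → 0 ≤ schrodingerEnergy (modelPotential K κ r (-h)) g := fun g hg => by
  have h1 := H _ hg.comp_neg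
  rw [← schrodingerEnergy_comp_neg] at h1
  have h2 : (fun x => modelPotential K κ r h (-x)) = modelPotential K κ r (-h) := by
    funext x
    simp only [modelPotential, logSlope_neg, neg_sq]
  simpa [h2] using h1

lemma schrodingerEnergy_nonneg_abs_iff {K κ r h L : ℝ} :
    (∀ g, IsDirichletTest L g → 0 ≤ schrodingerEnergy (modelPotential K κ r |h|) g) ↔
      ∀ g, IsDirichletTest L g → 0 ≤ schrodingerEnergy (modelPotential K κ r h) g := by
  rcases abs_choice h with hh | hh <;> rw [hh]
  refine ⟨fun H => ?_, schrodingerEnergy_nonneg_neg⟩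
  have := schrodingerEnergy_nonneg_neg H
  rwa [neg_neg] at this

lemma modelBase_abs_pos {K κ h L : ℝ} (hw : ∀ x ∈ Icc (-L) L, 0 < modelBase K κ h x) :
    ∀ x ∈ Icc (-L) L, 0 < modelBase K κ |h| x := fun x hx => by
  rcases abs_choice h with hh | hh <;> rw [hh]
  · exact hw x hx
  · rw [← modelBase_neg]
    exact hw _ (neg_mem_Icc_neg_self hx)

lemma spectralGap_mono_abs (hN : N ≠ ((1 : ℝ) : WithTop ℝ)) (hα : 0 ≤ 1 / 4 + dimInv N / 2)
    {h₁ h₂ d : ℝ} (hr₁ : (h₁, d) ∈ regularDomain K N D) (hr₂ : (h₂, d) ∈ regularDomain K N D)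
    (hh : |h₁| ≤ |h₂|) : spectralGap K N h₁ d ≤ spectralGap K N h₂ d := by
  refine spectralGap_le_of_forall fun r hr => ?_
  rw [le_spectralGap_iff hN hr₁, ← schrodingerEnergy_nonneg_abs_iff] at hr
  rw [le_spectralGap_iff hN hr₂, ← schrodingerEnergy_nonneg_abs_iff]
  rcases hh.eq_or_lt with hh | hh
  · rwa [← hh]
  have hw₁ := modelBase_abs_pos (modelBase_pos_of_mem_regularDomain hN hr₁)
  have hw₂ := modelBase_abs_pos (modelBase_pos_of_mem_regularDomain hN hr₂)
  have hp := (polarizesBelow_sq_logSlope (abs_nonneg h₁) hh hw₁ hw₂).affine hα (K / 2 - r)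
  exact fun g hg => hp.schrodingerEnergy_nonneg (continuousOn_modelPotential hw₁ r)
    (continuousOn_modelPotential hw₂ r) hr hg

lemma spectralGap_anti_abs (hN : N ≠ ((1 : ℝ) : WithTop ℝ)) (hα : 1 / 4 + dimInv N / 2 ≤ 0)
    {h₁ h₂ d : ℝ} (hr₁ : (h₁, d) ∈ regularDomain K N D) (hr₂ : (h₂, d) ∈ regularDomain K N D)
    (hh : |h₁| ≤ |h₂|) : spectralGap K N h₂ d ≤ spectralGap K N h₁ d := by
  refine spectralGap_le_of_forall fun r hr => ?_
  rw [le_spectralGap_iff hN hr₂, ← schrodingerEnergy_nonneg_abs_iff] at hr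
  rw [le_spectralGap_iff hN hr₁, ← schrodingerEnergy_nonneg_abs_iff]
  rcases hh.eq_or_lt with hh | hh
  · rwa [hh]
  have hw₁ := modelBase_abs_pos (modelBase_pos_of_mem_regularDomain hN hr₁)
  have hw₂ := modelBase_abs_pos (modelBase_pos_of_mem_regularDomain hN hr₂)
  have hp := (polarizesBelow_sq_logSlope (abs_nonneg h₁) hh hw₁ hw₂).affine_of_nonpos hα
    (K / 2 - r)
  exact fun g hg => hp.schrodingerEnergy_nonneg (continuousOn_modelPotential hw₂ r)
    (continuousOn_modelPotential hw₁ r) hr hg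

end

/-- The sign of the coefficient `1 / 4 + 1 / (2 (N - 1)) = (N + 1) / (4 (N - 1))`. -/
lemma quarter_add_dimInv_half {N : ℝ} (hN : N ≠ 1) :
    1 / 4 + dimInv (N : WithTop ℝ) / 2 = (N + 1) / (4 * (N - 1)) := by
  change 1 / 4 + (N - 1)⁻¹ / 2 = _
  have := sub_ne_zero.2 hN
  field_simp
  ring

end

theorem mainTheorem4 (K : ℝ) (N : WithTop ℝ) (hN : N ≤ ((0 : ℝ) : WithTop ℝ) ∨ ((1 : ℝ) : WithTop ℝ) < N)
    (D : ℝ) (hD : 0 < D) :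
    -- For fixed `h₀`, the spectral gap decreases as `d` increases.
    (∀ h₀ : ℝ, AntitoneOn (fun d => spectralGap K N h₀ d) {d | (h₀, d) ∈ regularDomain K N D}) ∧
    -- For fixed `d₀`, it is monotone in `|h|`, the direction depending on `N`.
    (∀ d₀ : ℝ,
      (N < ((-1 : ℝ) : WithTop ℝ) ∨ ((1 : ℝ) : WithTop ℝ) < N →
        ∀ h₁ h₂ : ℝ, (h₁, d₀) ∈ regularDomain K N D → (h₂, d₀) ∈ regularDomain K N D →
          |h₁| ≤ |h₂| → spectralGap K N h₁ d₀ ≤ spectralGap K N h₂ d₀) ∧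
      (((-1 : ℝ) : WithTop ℝ) < N ∧ N ≤ ((0 : ℝ) : WithTop ℝ) →
        ∀ h₁ h₂ : ℝ, (h₁, d₀) ∈ regularDomain K N D → (h₂, d₀) ∈ regularDomain K N D →
          |h₁| ≤ |h₂| → spectralGap K N h₂ d₀ ≤ spectralGap K N h₁ d₀) ∧
      (N = ((-1 : ℝ) : WithTop ℝ) →
        ∀ h₁ h₂ : ℝ, (h₁, d₀) ∈ regularDomain K N D → (h₂, d₀) ∈ regularDomain K N D →
          spectralGap K N h₁ d₀ = spectralGap K N h₂ d₀)) := by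
  have hN1 : N ≠ ((1 : ℝ) : WithTop ℝ) := by
    rintro rfl
    rcases hN with h | h
    · exact absurd (WithTop.coe_le_coe.1 h) (by norm_num)
    · exact lt_irrefl _ h
  refine ⟨fun h₀ d₁ hd₁ d₂ hd₂ hd => spectralGap_anti_length hN1 hd₁ hd₂ hd,
    fun d₀ => ⟨fun hN' h₁ h₂ hr₁ hr₂ hh => spectralGap_mono_abs hN1 ?_ hr₁ hr₂ hh,
      fun hN' h₁ h₂ hr₁ hr₂ hh => spectralGap_anti_abs hN1 ?_ hr₁ hr₂ hh,
      fun hN' h₁ h₂ hr₁ hr₂ => ?_⟩⟩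
  · induction N using WithTop.recTopCoe with
    | top => norm_num [dimInv]
    | coe N =>
      rw [quarter_add_dimInv_half fun h => hN1 (by rw [h])]
      rcases hN' with h | h
      · have h' := WithTop.coe_lt_coe.1 h
        exact div_nonneg_of_nonpos (by linarith) (by linarith)
      · have h' := WithTop.coe_lt_coe.1 h
        exact div_nonneg (by linarith) (by linarith)
  · induction N using WithTop.recTopCoe with
    | top => exact absurd hN'.2 (by simp)
    | coe N =>
      rw [quarter_add_dimInv_half fun h => hN1 (by rw [h])]
      have h1 := WithTop.coe_lt_coe.1 hN'.1
      have h2 := WithTop.coe_le_coe.1 hN'.2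
      exact div_nonpos_of_nonneg_of_nonpos (by linarith) (by linarith)
  · subst hN'
    have hα : 1 / 4 + dimInv ((-1 : ℝ) : WithTop ℝ) / 2 = 0 := by
      rw [quarter_add_dimInv_half (by norm_num)]
      norm_num
    rcases le_total |h₁| |h₂| with hh | hh
    · exact le_antisymm (spectralGap_mono_abs hN1 hα.ge hr₁ hr₂ hh)
        (spectralGap_anti_abs hN1 hα.le hr₁ hr₂ hh)
    · exact le_antisymm (spectralGap_anti_abs hN1 hα.le hr₂ hr₁ hh)
        (spectralGap_mono_abs hN1 hα.ge hr₂ hr₁ hh)
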